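/- Let $q$ be an indeterminate, and use fractional powers $q^{r/4}$, $r\in\mathbb Z$. Put $(q)_n=\prod_{j=1}^n(1-q^j)$ and $\left[{n+m\atop n}\right]_q=\frac{(q)_{n+m}}{(q)_n(q)_m}$ for integers $n,m\ge 0$, and $\left[{n+m\atop n}\right]_q=0$ for all other integers $n,m$. Fix an integer $p\ge 4$. Vectors have $p-1$ components labelled $0,\dots,p-2$; $\mathbf e_k$ is the $k$-th unit vector for $0\le k\le p-2$ and $\mathbf e_k=0$ otherwise. Let $\tilde I$ be the $(p-1)\times(p-1)$ matrix with $\tilde I_{0,j}=-\tilde I_{j,0}=-\delta_{j,2}$ for $0\le j\le p-2$ and $\tilde I_{i,j}=\delta_{i,j+1}+\delta_{i,j-1}$ for $1\le i,j\le p-2$, and let $\tilde C=2-\tilde I$. For $1\le a\le p-2$ and $1\le b\le p-1$ let $\pi\in\{0,1\}$ be the parity of $a+\delta_{a,1}+b+\delta_{b,1}$, let $\theta(S)=1$ if $S$ is true and $\theta(S)=0$ otherwise, and set $$\mathbf u_{a,b}=\theta(a>1)\,\mathbf e_a+\theta(b>1)\,\mathbf e_b+\pi(\mathbf e_1-\mathbf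 e_0),\qquad \mathbf A_{a,b}=\theta(b>1)\,\mathbf e_b+\pi\,\mathbf e_1 .$$ For $L\in\mathbb Z$ define the (finite) sum $$F^{p,0}_{a,b}(L)=\sum_{(\mathbf n,\mathbf m)} q^{\frac14\mathbf m\tilde C\mathbf m-\frac12\mathbf A_{a,b}\cdot\mathbf m}\prod_{j=0}^{p-2}\left[{n_j+m_j\atop n_j}\right]_q$$ over all $\mathbf n,\mathbf m\in\mathbb Z^{p-1}$ with $\mathbf n+\mathbf m=\frac12\tilde I\mathbf m+L\mathbf e_0+\frac12\mathbf u_{a,b}$ and with $m_{p-2}$ even if $b\ne p-1$, odd if $b=p-1$. Put $F^{p,0}_{a,p}(L)=0$. Abbreviate $F_b(L)=F^{p,0}_{a,b}(L)$. Then for all integers $p\ge4$, $1\le a\le p-2$ and $L\ge 1$: 1. if $a+\delta_{a,1}$ is even, $F_1(L)=F_1(L-1)+q^{L-\frac12}F_2(L-1)$; 2. if $a+\delta_{a,1}$ is odd, $F_1(L)=F_1(L-1)+q^{L-1}F_2(L-1)$; 3. if $a+\delta_{a,1}$ is even, $F_2(L)=q^{L-1}F_3(L-1)+q^{L-\frac12}F_1(L-1)+F_2(L-1)$;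 4. if $a+\delta_{a,1}$ is odd, $F_2(L)=q^{-\frac12}F_3(L-1)+F_1(L-1)+q^{L-1}F_2(L-1)$; 5. if $2<b\le p-1$ and $a+b+\delta_{a,1}$ is even, $$F_b(L)=q^{L-1}F_{b+1}(L-1)+q^{L-\frac12}F_{b-1}(L-1)+F_b(L-1)+q^{L-1}(q^{L-1}-1)F_b(L-2);$$ 6. if $2<b\le p-1$ and $a+b+\delta_{a,1}$ is odd, $$\begin{aligned}F_b(L)={}&q^{-\frac12}\{F_{b+1}(L-1)+(q^{L-1}-1)F_{b+1}(L-2)\}+\{F_{b-1}(L-1)+(q^{L-1}-1)F_{b-1}(L-2)\}\\&+\{F_b(L-1)+q^{L-2}(q^{L-1}-1)F_b(L-2)\}.\end{aligned}$$ -/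

import Mathlib

open scoped Matrix

namespace FermionicForm

/-- The `q`-series below are formal: they live in the field `ℚ(t)` with `t = q^{1/4}`,
so that every quarter-integral power `q^{r/4} = t ^ r` is available. -/
noncomputable def t : RatFunc ℚ := RatFunc.X

/-- The indeterminate `q`. -/
noncomputable def q : RatFunc ℚ := t ^ 4

/-- The square root of `q`. -/
noncomputable def sqrtq : RatFunc ℚ := t ^ 2

/-- `(q)_n = (1 - q) (1 - q ^ 2) ⋯ (1 - q ^ n)`. -/
noncomputable def qPochhammer (n : ℕ) : RatFunc ℚ := ∏ j ∈ Finset.range n, (1 - q ^ (j + 1))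

/-- The `q`-binomial coefficient `[n + m ; n]_q`: it equals `(q)_{n+m} / ((q)_n (q)_m)` if
`n, m ≥ 0` and vanishes otherwise. -/
noncomputable def qBinom (n m : ℤ) : RatFunc ℚ :=
  if 0 ≤ n ∧ 0 ≤ m then
    qPochhammer (n + m).toNat / (qPochhammer n.toNat * qPochhammer m.toNat)
  else 0

/-- Integral vectors of dimension `p - 1`, with components labelled `0, 1, …, p - 2`. -/
abbrev Vec (p : ℕ) : Type := Fin (p - 1) → ℤ

/-- The unit vector in direction `a`; it is zero unless `0 ≤ a ≤ p - 2`. -/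
def e (p a : ℕ) : Vec p := fun j => if (j : ℕ) = a then 1 else 0

/-- The incidence matrix `Ĩ_{p-1}`. -/
def incidence (p : ℕ) : Matrix (Fin (p - 1)) (Fin (p - 1)) ℤ := Matrix.of fun i j =>
  if (i : ℕ) = 0 then (if (j : ℕ) = 2 then -1 else 0)
  else if (j : ℕ) = 0 then (if (i : ℕ) = 2 then 1 else 0)
  else if (i : ℕ) = j + 1 ∨ (j : ℕ) = i + 1 then 1 else 0

/-- The matrix `C̃_{p-1} = 2 - Ĩ_{p-1}`. -/
def cartan (p : ℕ) : Matrix (Fin (p - 1)) (Fin (p - 1)) ℤ := 2 - incidence p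

/-- The integer solutions `(n, m)` of `n + m = (1/2) Ĩ m + L e_0 + (1/2) u` with
`m_{p-2} ≡ k (mod 2)`. -/
def nmSystem (p : ℕ) (k L : ℤ) (u : Vec p) : Set (Vec p × Vec p) :=
  {x | (2 : ℤ) • (x.1 + x.2) = incidence p *ᵥ x.2 + (2 * L) • e p 0 + u ∧
    ∀ j : Fin (p - 1), (j : ℕ) = p - 2 → x.2 j ≡ k [ZMOD 2]}

/-- The summand `q ^ (m C̃ m / 4 - A ⬝ m / 2) ∏_j [n_j + m_j ; n_j]_q`. -/
noncomputable def summand (p : ℕ) (A : Vec p) (x : Vec p × Vec p) : RatFunc ℚ :=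
  t ^ (x.2 ⬝ᵥ (cartan p *ᵥ x.2) - 2 * (A ⬝ᵥ x.2)) * ∏ j, qBinom (x.1 j) (x.2 j)

/-- The fundamental fermionic form `f^p_k(L; u; A)`. Only finitely many summands are nonzero,
see `finite_summands`. -/
noncomputable def fermForm (p : ℕ) (k L : ℤ) (u A : Vec p) : RatFunc ℚ :=
  ∑ᶠ x ∈ nmSystem p k L u, summand p A x

/-- The number `a + δ_{a,1} + b + δ_{b,1} + δ_{i,1} (p - 1)` reduced modulo 2 to `0` or `1`. -/
def parity (p i a b : ℕ) : ℤ :=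
  ((a + (if a = 1 then 1 else 0) + b + (if b = 1 then 1 else 0) +
    (if i = 1 then p - 1 else 0)) % 2 : ℕ)

/-- The vector `u^i_{a,b}`. -/
def uVec (p i a b : ℕ) : Vec p :=
  (if 1 < a then e p a else 0) + (if 1 < b then e p b else 0) +
    parity p i a b • (e p 1 - e p 0)

/-- The vector `A^i_{a,b}`. -/
def aVec (p i a b : ℕ) : Vec p :=
  (if 1 < b then e p b else 0) + parity p i a b • e p 1

/-- The fermionic polynomial `F^{p,i}_{a,b}(L)` for `1 ≤ b ≤ p - 1`, together with the closing
convention `F^{p,i}_{a,p}(L) = 0`. -/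
noncomputable def F (p i a b : ℕ) (L : ℤ) : RatFunc ℚ :=
  if b = p then 0
  else if b = p - 1 then fermForm p (1 - i) L (uVec p i a b) (aVec p i a b)
  else fermForm p i L (uVec p i a b) (aVec p i a b)

/-- A vector extended by zero to all natural indices. -/
def ext {p : ℕ} (m : Vec p) (k : ℕ) : ℤ := if h : k < p - 1 then m ⟨k, h⟩ else 0

theorem incidence_mulVec {p : ℕ} (hp : 4 ≤ p) (m : Vec p) (i : Fin (p - 1)) :
    (incidence p *ᵥ m) i =
      if (i : ℕ) = 0 then -ext m 2
      else (if (i : ℕ) = 1 then 0 else ext m (i - 1)) + ext m (i + 1) +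
        (if (i : ℕ) = 2 then ext m 0 else 0) := by
  have key : ∀ k : ℕ, ∑ j : Fin (p - 1), (if (j : ℕ) = k then m j else 0) = ext m k := by
    intro k
    unfold ext
    split_ifs with h
    · rw [Finset.sum_eq_single ⟨k, h⟩]
      · simp
      · intro b _ hb
        rw [if_neg]
        intro h'
        exact hb (Fin.ext h')
      · simp
    · apply Finset.sum_eq_zero
      intro j _
      rw [if_neg]
      have := j.2
      omega
  simp only [Matrix.mulVec, dotProduct]
  by_cases h0 : (i : ℕ) = 0
  · rw [if_pos h0, ← key 2, ← Finset.sum_neg_distrib]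
    apply Finset.sum_congr rfl
    intro j _
    simp only [incidence, Matrix.of_apply, if_pos h0]
    split_ifs <;> simp
  · rw [if_neg h0]
    have h1 : (if (i : ℕ) = 1 then 0 else ext m (i - 1)) =
        ∑ j : Fin (p - 1), (if (i : ℕ) = 1 then 0 else if (j : ℕ) = i - 1 then m j else 0) := by
      split_ifs
      · simp
      · rw [key]
    have h2 : (if (i : ℕ) = 2 then ext m 0 else 0) =
        ∑ j : Fin (p - 1), (if (i : ℕ) = 2 then (if (j : ℕ) = 0 then m j else 0) else 0) := by
      split_ifs
      · rw [key]
      · simp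
    rw [h1, h2, ← key (i + 1), ← Finset.sum_add_distrib, ← Finset.sum_add_distrib]
    apply Finset.sum_congr rfl
    intro j _
    simp only [incidence, Matrix.of_apply]
    split_ifs <;> omega

/-- The sum defining `fermForm` is finite. -/
theorem finite_summands {p : ℕ} (hp : 4 ≤ p) (k L : ℤ) (u A : Vec p) :
    (nmSystem p k L u ∩ Function.support (summand p A)).Finite := by
  obtain ⟨U, hU0, hU⟩ : ∃ U : ℤ, 0 ≤ U ∧ ∀ j, u j ≤ U := by
    refine ⟨∑ j, |u j|, Finset.sum_nonneg fun j _ => abs_nonneg _, fun j => ?_⟩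
    exact (le_abs_self _).trans
      (Finset.single_le_sum (f := fun j => |u j|) (fun j _ => abs_nonneg _) (Finset.mem_univ j))
  obtain ⟨C, hC⟩ : ∃ C : ℤ, ∀ x ∈ nmSystem p k L u ∩ Function.support (summand p A),
      ∀ j, 0 ≤ x.2 j ∧ x.2 j ≤ C := by
    refine ⟨2 * |L| + U + (p : ℤ) * ((p : ℤ) * U), ?_⟩
    rintro ⟨n, m⟩ ⟨⟨hx, -⟩, hs⟩
    have hnn : ∀ j, 0 ≤ n j ∧ 0 ≤ m j := by
      intro j
      by_contra hj
      apply hs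
      simp only [summand]
      rw [Finset.prod_eq_zero (Finset.mem_univ j), mul_zero]
      simp only [qBinom, if_neg hj]
    have hc : ∀ j, 2 * m j ≤ (incidence p *ᵥ m) j + 2 * L * e p 0 j + u j := by
      intro j
      have := congrFun hx j
      simp only [Pi.smul_apply, Pi.add_apply, smul_eq_mul] at this
      have := hnn j
      omega
    have hpos : ∀ j, 0 ≤ ext m j := by
      intro j
      unfold ext
      split_ifs
      · exact (hnn _).2
      · exact le_refl _
    have hext : ∀ j : Fin (p - 1), m j = ext m j := by
      intro j
      simp [ext]
    have h0 : 2 * ext m 0 + ext m 2 ≤ 2 * L + U := by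
      have h := hc ⟨0, by omega⟩
      rw [incidence_mulVec hp, hext] at h
      have := hU ⟨0, by omega⟩
      simp [e] at h
      omega
    have h1 : 2 * ext m 1 ≤ ext m 2 + U := by
      have h := hc ⟨1, by omega⟩
      rw [incidence_mulVec hp, hext] at h
      have := hU ⟨1, by omega⟩
      simp [e] at h
      omega
    have h3 : ∀ i, 2 ≤ i → 2 * ext m (i + 1) ≤ ext m i + ext m (i + 2) + U := by
      intro i hi
      by_cases hip : i + 1 < p - 1
      · have h := hc ⟨i + 1, hip⟩
        rw [incidence_mulVec hp, hext] at h
        have := hU ⟨i + 1, hip⟩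
        have hi1 : i ≠ 1 := by omega
        have hi0 : i ≠ 0 := by omega
        simp [e, hi1, hi0] at h
        rw [show i + 1 + 1 = i + 2 by omega] at h
        omega
      · have h4 : ext m (i + 1) = 0 := by simp [ext, hip]
        have := hpos i
        have := hpos (i + 2)
        omega
    have h4 : ∀ d i : ℕ, 2 ≤ i → p ≤ i + 1 + d → ext m (i + 1) ≤ ext m i + d * U := by
      intro d
      induction d with
      | zero =>
        intro i hi hd
        have h4 : ext m (i + 1) = 0 := by
          unfold ext
          rw [dif_neg]
          omega
        have := hpos i
        simp
        omega
      | succ d ih =>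
        intro i hi hd
        have := ih (i + 1) (by omega) (by omega)
        have := h3 i hi
        push_cast
        rw [show i + 2 = i + 1 + 1 by omega] at *
        linarith
    have h5 : ∀ i : ℕ, ext m (i + 2) ≤ ext m 2 + i * (p * U) := by
      intro i
      induction i with
      | zero => simp
      | succ i ih =>
        have := h4 p (i + 2) (by omega) (by omega)
        rw [show i + 1 + 2 = i + 2 + 1 by omega]
        push_cast
        linarith
    have hL := le_abs_self L
    have hpU : 0 ≤ (p : ℤ) * U := by positivity
    have hpp : 0 ≤ (p : ℤ) * ((p : ℤ) * U) := by positivity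
    have g0 := hpos 0
    have g1 := hpos 1
    have g2 := hpos 2
    have hUp : U ≤ (p : ℤ) * ((p : ℤ) * U) := by
      have : (4 : ℤ) ≤ p := by exact_mod_cast hp
      nlinarith
    rintro ⟨j, hj⟩
    refine ⟨(hnn _).2, ?_⟩
    rw [show (n, m).2 ⟨j, hj⟩ = ext m j from hext ⟨j, hj⟩]
    rcases j with _ | _ | j
    · linarith
    · show ext m 1 ≤ _
      linarith
    · show ext m (j + 2) ≤ _
      have h6 := h5 j
      have : (j : ℤ) ≤ p := by
        have : j ≤ p := by omega
        exact_mod_cast this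
      have : (j : ℤ) * (p * U) ≤ p * (p * U) := mul_le_mul_of_nonneg_right this hpU
      linarith
  refine ((Set.finite_Icc (0 : Vec p) (fun _ => C)).image
    (fun m : Vec p => ((fun j => (incidence p *ᵥ m + (2 * L) • e p 0 + u) j / 2 - m j), m))).subset ?_
  rintro ⟨n, m⟩ hx
  refine ⟨m, ⟨fun j => (hC _ hx j).1, fun j => (hC _ hx j).2⟩, ?_⟩
  refine Prod.ext (funext fun j => ?_) rfl
  have := congrFun hx.1.1 j
  simp only [Pi.smul_apply, Pi.add_apply, smul_eq_mul] at this ⊢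
  omega

end FermionicForm

namespace FermionicForm

/-! The upper entries of the binomials at `0` and `1` are `L - (m_2 + π)/2` and `(m_2 + π)/2`, with
sum `L`. Summing over `m_0` and `m_1` with fixed sum is therefore a `q`-Vandermonde convolution and
leaves a single binomial with upper entry `L`. This identifies `F_b(L)` with a reduced form `red`
whose linear term is `v = π e_1 + θ(b>1) e_b` (`F_eq_red`). Vandermonde needs both upper entries
nonnegative; `le_two_mul_of_redTerm_ne_zero` shows that the reduced summands vanish otherwise.

Reduced forms with the same `w` and different `v` obey contiguity relations. For `j ≥ 2`, Pascal's
rule at the `j`-th binomial relates `v + 2e_j`, `v` and `v + e_{j-1} + e_{j+1}` (`red_add_two`). For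
`j = 1` the upper entry is `L`, and the two absorption identities lower the level
(`red_add_two_sub`, `red_eq_level`, hence `red_level`, `red_level'`).

Lowering the level of `e_b` creates `e_2 + e_b`. A telescoping chain of contiguity relations in
directions `2, …, b` fuses these two unit vectors into `e_{b+1}` and `e_{b-1}`, up to a correction
that drops the level once more (`red_fusion`). Linear algebra then yields the six recurrences. -/

/-! ### Powers of `q` and `q`-binomial identities -/

theorem t_ne_zero : t ≠ 0 := RatFunc.X_ne_zero

theorem q_ne_zero : q ≠ 0 := pow_ne_zero _ t_ne_zero

theorem q_zpow (n : ℤ) : q ^ n = t ^ (4 * n) := by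
  rw [q, ← zpow_natCast, ← zpow_mul]; rfl

theorem q_pow_ne_one {n : ℕ} (hn : n ≠ 0) : q ^ n ≠ 1 := by
  intro h
  have h1 : (algebraMap (Polynomial ℚ) (RatFunc ℚ)) (Polynomial.X ^ (4 * n)) =
      algebraMap (Polynomial ℚ) (RatFunc ℚ) 1 := by
    rw [map_pow, RatFunc.algebraMap_X, map_one, pow_mul]
    exact h
  have h2 := congrArg Polynomial.natDegree (IsFractionRing.injective (Polynomial ℚ) (RatFunc ℚ) h1)
  simp at h2
  omega

theorem q_zpow_ne_one {n : ℤ} (hn : n ≠ 0) : q ^ n ≠ 1 := by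
  intro h
  obtain ⟨k, rfl | rfl⟩ := n.eq_nat_or_neg
  · rw [zpow_natCast] at h
    exact q_pow_ne_one (by simpa using hn) h
  · rw [zpow_neg, inv_eq_one, zpow_natCast] at h
    exact q_pow_ne_one (by simpa using hn) h

theorem one_sub_q_zpow_ne_zero {n : ℤ} (hn : n ≠ 0) : 1 - q ^ n ≠ 0 :=
  sub_ne_zero.2 (q_zpow_ne_one hn).symm

theorem qPochhammer_ne_zero (n : ℕ) : qPochhammer n ≠ 0 := by
  rw [qPochhammer, Finset.prod_ne_zero_iff]
  intro j _
  exact sub_ne_zero.2 (q_pow_ne_one (Nat.succ_ne_zero j)).symm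

theorem qPochhammer_succ (n : ℕ) : qPochhammer (n + 1) = qPochhammer n * (1 - q ^ (n + 1)) :=
  Finset.prod_range_succ _ _

theorem qBinom_natCast (n m : ℕ) :
    qBinom n m = qPochhammer (n + m) / (qPochhammer n * qPochhammer m) := by
  rw [qBinom, if_pos ⟨by positivity, by positivity⟩]
  norm_cast

theorem qBinom_of_neg_left {n m : ℤ} (h : n < 0) : qBinom n m = 0 := if_neg (by omega)

theorem qBinom_of_neg_right {n m : ℤ} (h : m < 0) : qBinom n m = 0 := if_neg (by omega)

theorem nonneg_of_qBinom_ne_zero {n m : ℤ} (h : qBinom n m ≠ 0) : 0 ≤ n ∧ 0 ≤ m := by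
  by_contra h'
  exact h (if_neg h')

theorem qBinom_comm (n m : ℤ) : qBinom n m = qBinom m n := by
  simp only [qBinom, and_comm, add_comm, mul_comm]

theorem qBinom_zero_right {n : ℤ} (h : 0 ≤ n) : qBinom n 0 = 1 := by
  lift n to ℕ using h
  have := qBinom_natCast n 0
  simp only [Nat.cast_zero, add_zero] at this
  rw [this]
  have h0 : qPochhammer 0 = 1 := rfl
  rw [h0, mul_one, div_self (qPochhammer_ne_zero n)]

theorem one_sub_mul_qBinom (n m : ℤ) :
    (1 - q ^ m) * qBinom n m = (1 - q ^ (n + m)) * qBinom n (m - 1) := by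
  rcases lt_or_ge n 0 with hn | hn
  · simp [qBinom_of_neg_left hn]
  rcases lt_trichotomy m 0 with hm | rfl | hm
  · rw [qBinom_of_neg_right hm, qBinom_of_neg_right (by omega : m - 1 < 0)]
    simp
  · rw [qBinom_of_neg_right (by omega : (0 : ℤ) - 1 < 0)]
    simp
  · lift n to ℕ using hn
    obtain ⟨k, rfl⟩ : ∃ k : ℕ, m = k + 1 := ⟨(m - 1).toNat, by omega⟩
    have h1 := qBinom_natCast n (k + 1)
    push_cast at h1
    rw [add_sub_cancel_right, h1, qBinom_natCast, ← add_assoc n k 1, qPochhammer_succ,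
      qPochhammer_succ k]
    have e1 : q ^ ((k : ℤ) + 1) = q ^ (k + 1) := by norm_cast
    have e2 : q ^ ((n : ℤ) + ((k : ℤ) + 1)) = q ^ (n + k + 1) := by
      rw [← add_assoc]; norm_cast
    rw [e1, e2]
    have := qPochhammer_ne_zero n
    have := qPochhammer_ne_zero k
    have : 1 - q ^ (k + 1) ≠ 0 := sub_ne_zero.2 (q_pow_ne_one (Nat.succ_ne_zero k)).symm
    field_simp

theorem one_sub_mul_qBinom' (n m : ℤ) :
    (1 - q ^ n) * qBinom n m = (1 - q ^ (n + m)) * qBinom (n - 1) m := by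
  rw [qBinom_comm n m, qBinom_comm (n - 1) m, one_sub_mul_qBinom, add_comm]

/-- Both absorption identities hold for all integers, so multiplying by `1 - q ^ (n + m)` proves the
rule with no sign conditions. The hypothesis excludes `n = m = 0`, where the rule would read `1 =
0`. -/
theorem qBinom_pascal {n m : ℤ} (h : n + m ≠ 0) :
    qBinom n m = qBinom n (m - 1) + q ^ m * qBinom (n - 1) m := by
  apply mul_left_cancel₀ (one_sub_q_zpow_ne_zero h)
  have h1 := one_sub_mul_qBinom n m
  have h2 := one_sub_mul_qBinom' n m
  have h3 := zpow_add₀ q_ne_zero n m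
  rw [mul_add, ← h1, mul_left_comm, ← h2, h3]
  ring

theorem qBinom_pascal' {n m : ℤ} (h : n + m ≠ 0) :
    qBinom n m = qBinom (n - 1) m + q ^ n * qBinom n (m - 1) := by
  rw [qBinom_comm n m, qBinom_pascal (by omega), qBinom_comm m, qBinom_comm (m - 1)]

/-- The `q`-Vandermonde convolution. -/
theorem finsum_qBinom_mul_qBinom (A B k : ℤ) (hA : 0 ≤ A) (hB : 0 ≤ B) :
    ∑ᶠ i : ℤ, q ^ ((k - i) * (B - i)) * qBinom (B - i) i * qBinom (A - (k - i)) (k - i) =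
      qBinom (A + B - k) k := by
  have hfin : ∀ (A k : ℤ) (c : ℤ → RatFunc ℚ), (Function.support fun i : ℤ =>
      c i * qBinom (B - i) i * qBinom (A - (k - i)) (k - i)).Finite := by
    intro A k c
    refine (Set.finite_Icc (0 : ℤ) B).subset fun i hi => ?_
    have := nonneg_of_qBinom_ne_zero (right_ne_zero_of_mul (left_ne_zero_of_mul hi))
    exact ⟨this.2, by omega⟩
  lift A to ℕ using hA
  induction A generalizing k with
  | zero =>
    rw [finsum_eq_single _ k]
    · simp [qBinom_zero_right]
    · intro i hi
      rcases lt_or_gt_of_ne hi with h | h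
      · rw [qBinom_of_neg_left (n := _ - (k - i)) (by push_cast; omega), mul_zero]
      · rw [qBinom_of_neg_right (m := k - i) (by omega), mul_zero]
  | succ A ih =>
    -- Pascal's rule on the second binomial; the power of `q` it produces combines with the weight
    -- so that the factor in front of the `k - 1` sum is free of `i`.
    have h1 : ∀ i : ℤ, q ^ ((k - i) * (B - i)) * qBinom (B - i) i *
        qBinom (((A + 1 : ℕ) : ℤ) - (k - i)) (k - i) =
        q ^ ((k - i) * (B - i)) * qBinom (B - i) i * qBinom (A - (k - i)) (k - i) +
        q ^ (A + 1 + B - k) * (q ^ ((k - 1 - i) * (B - i)) * qBinom (B - i) i *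
          qBinom (A - (k - 1 - i)) (k - 1 - i)) := by
      intro i
      rw [qBinom_pascal' (n := ((A + 1 : ℕ) : ℤ) - (k - i)) (by push_cast; omega),
        show ((A + 1 : ℕ) : ℤ) - (k - i) - 1 = A - (k - i) by push_cast; ring,
        show ((A + 1 : ℕ) : ℤ) - (k - i) = A - (k - 1 - i) by push_cast; ring,
        show k - i - 1 = k - 1 - i by ring]
      have : q ^ ((k - i) * (B - i)) * q ^ ((A : ℤ) - (k - 1 - i)) =
          q ^ (A + 1 + B - k) * q ^ ((k - 1 - i) * (B - i)) := by
        rw [← zpow_add₀ q_ne_zero, ← zpow_add₀ q_ne_zero]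
        congr 1
        ring
      linear_combination (qBinom (B - i) i * qBinom (A - (k - 1 - i)) (k - 1 - i)) * this
    rw [finsum_congr h1, finsum_add_distrib (hfin _ _ _), ← mul_finsum, ih, ih,
      qBinom_pascal' (n := ((A + 1 : ℕ) : ℤ) + B - k) (by push_cast; omega)]
    · push_cast
      rw [show (A : ℤ) + 1 + B - k - 1 = A + B - k by ring,
        show (A : ℤ) + B - (k - 1) = A + 1 + B - k by ring]
    · refine ((hfin A (k - 1) fun i => q ^ ((k - 1 - i) * (B - i))).subset fun i hi => ?_)
      exact right_ne_zero_of_mul hi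

/-! ### The reduced form and its summands -/

/-- The Kronecker symbol. -/
def kron (b i : ℕ) : ℤ := if i = b then 1 else 0

/-- The vector `e_{j-1} + e_{j+1}`. -/
def nbr (j i : ℕ) : ℤ := if i + 1 = j ∨ i = j + 1 then 1 else 0

/-- The quarter-integral exponent of a summand of the reduced form. -/
def redExp (p : ℕ) (v m : ℕ → ℤ) : ℤ :=
  ∑ j ∈ Finset.range (p - 1), 2 * (m j * (m j - m (j + 1) - v j))

/-- The vectors `m` summed over in the reduced form. -/
def Admissible (p : ℕ) (w v m : ℕ → ℤ) : Prop :=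
  (∀ j, j = 0 ∨ p - 1 ≤ j → m j = 0) ∧
    ∀ j, 1 ≤ j → j ≤ p - 1 → Even (m (j - 1) + m (j + 1) + v j + w j)

/-- The upper entries of the `q`-binomial coefficients of the reduced form. -/
def top (w : ℕ → ℤ) (L : ℤ) (v m : ℕ → ℤ) (j : ℕ) : ℤ :=
  if j = 1 then L else (m (j - 1) + m (j + 1) + v j + w j) / 2

open Classical in
/-- A summand of the reduced form. -/
noncomputable def redTerm (p : ℕ) (w : ℕ → ℤ) (L : ℤ) (v m : ℕ → ℤ) : RatFunc ℚ :=
  if Admissible p w v m then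
    t ^ redExp p v m * ∏ j ∈ Finset.Icc 1 (p - 2), qBinom (top w L v m j - m j) (m j)
  else 0

/-- The reduced form, in which the variables `m_0` and `m_1` of the fermionic form are replaced
by their sum. -/
noncomputable def red (p : ℕ) (w : ℕ → ℤ) (L : ℤ) (v : ℕ → ℤ) : RatFunc ℚ :=
  ∑ᶠ m, redTerm p w L v m

variable {p : ℕ} {w : ℕ → ℤ} {L : ℤ} {v v' v'' m : ℕ → ℤ}

theorem admissible_congr (h : ∀ i, 1 ≤ i → i ≤ p - 1 → (Even (v' i) ↔ Even (v i))) :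
    Admissible p w v' m ↔ Admissible p w v m := by
  unfold Admissible
  refine and_congr_right fun _ => forall_congr' fun j => forall_congr' fun h1 =>
    forall_congr' fun h2 => ?_
  simp only [Int.even_add, h j h1 h2]

theorem redExp_congr_add (c : ℤ) (j : ℕ) (h0 : m 0 = 0) (hj : j ≤ p - 2) (h1 : 1 ≤ j)
    (h : ∀ i, 1 ≤ i → i ≤ p - 2 → v' i = v i + c * kron j i) :
    redExp p v' m = redExp p v m - 2 * c * m j := by
  unfold redExp
  rw [sub_eq_add_neg, ← Finset.sum_ite_eq_of_mem' (Finset.range (p - 1)) j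
    (fun j => -(2 * c * m j)) (Finset.mem_range.2 (by omega)), ← Finset.sum_add_distrib]
  refine Finset.sum_congr rfl fun i hi => ?_
  rw [Finset.mem_range] at hi
  rcases Nat.eq_zero_or_pos i with rfl | hi0
  · rw [if_neg (by omega), h0]; ring
  · rw [h i hi0 (by omega), kron]
    split_ifs with h'
    · subst h'; ring
    · ring

theorem redExp_nbr (j : ℕ) (h0 : ∀ j, j = 0 ∨ p - 1 ≤ j → m j = 0) (hj : j ≤ p - 2) (h1 : 1 ≤ j)
    (h : ∀ i, 1 ≤ i → i ≤ p - 2 → v' i = v i + nbr j i) :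
    redExp p v' m = redExp p v m - 2 * m (j - 1) - 2 * m (j + 1) := by
  -- Also valid for `k` outside the range of summation, as happens for `k = j + 1` with `j = p - 2`,
  -- because `m` vanishes there.
  have key : ∀ k, -(2 * m k) =
      ∑ i ∈ Finset.range (p - 1), if i = k then -(2 * m i) else 0 := by
    intro k
    by_cases hk : k < p - 1
    · rw [Finset.sum_ite_eq_of_mem' _ _ _ (Finset.mem_range.2 hk)]
    · rw [Finset.sum_ite_eq', if_neg (by simpa using hk), h0 k (by omega)]; rfl
  unfold redExp
  rw [sub_eq_add_neg, sub_eq_add_neg, key, key, ← Finset.sum_add_distrib,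
    ← Finset.sum_add_distrib]
  refine Finset.sum_congr rfl fun i hi => ?_
  rw [Finset.mem_range] at hi
  rcases Nat.eq_zero_or_pos i with rfl | hi0
  · rw [h0 0 (by simp)]; simp
  · rw [h i hi0 (by omega), nbr]
    split_ifs <;> first | omega | ring

theorem redExp_add_kron (j : ℕ) (hj : j ≤ p - 2) (h1 : 1 ≤ j) :
    redExp p v (m + kron j) =
      redExp p v m + 2 * (2 * m j + 1 - m (j - 1) - m (j + 1) - v j) := by
  unfold redExp
  have key : ∀ (k : ℕ) (f : ℕ → ℤ), k < p - 1 → f k =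
      ∑ i ∈ Finset.range (p - 1), if i = k then f i else 0 := by
    intro k f hk
    rw [Finset.sum_ite_eq_of_mem' _ _ _ (Finset.mem_range.2 hk)]
  have e1 := key j (fun j => 2 * (2 * m j + 1 - m (j + 1) - v j)) (by omega)
  have e2 := key (j - 1) (fun j => -2 * m j) (by omega)
  rw [show 2 * (2 * m j + 1 - m (j - 1) - m (j + 1) - v j) =
    2 * (2 * m j + 1 - m (j + 1) - v j) + (-2 * m (j - 1)) by ring, e1, e2,
    ← Finset.sum_add_distrib, ← Finset.sum_add_distrib]
  refine Finset.sum_congr rfl fun i hi => ?_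
  simp only [Pi.add_apply, kron]
  have hij : i + 1 = j ↔ i = j - 1 := by omega
  by_cases hi1 : i = j
  · subst hi1
    rw [if_pos rfl, if_neg (by omega), if_pos rfl, if_neg (by omega)]
    ring
  · by_cases hi2 : i = j - 1
    · rw [if_neg hi1, if_pos (hij.2 hi2), if_neg hi1, if_pos hi2]
      ring
    · rw [if_neg hi1, if_neg (mt hij.1 hi2), if_neg hi1, if_neg hi2]
      ring

/-- Shifting `m_j` by one flips the parity conditions at `j - 1` and `j + 1` only, which is what
adding `nbr j` to `v` does as well. -/
theorem admissible_add_kron (j : ℕ) (hj : j ≤ p - 2) (h1 : 1 ≤ j)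
    (h : ∀ i, 1 ≤ i → i ≤ p - 1 → (Even (v' i) ↔ Even (v i + nbr j i))) :
    Admissible p w v' m ↔ Admissible p w v (m + kron j) := by
  unfold Admissible
  refine and_congr (forall_congr' fun i => forall_congr' fun hi => ?_) (forall_congr' fun i =>
    forall_congr' fun hi1 => forall_congr' fun hi2 => ?_)
  · rw [Pi.add_apply, kron, if_neg (by omega), add_zero]
  · have h3 : nbr j i = kron j (i - 1) + kron j (i + 1) := by
      unfold nbr kron
      split_ifs <;> omega
    have := h i hi1 hi2
    rw [h3] at this
    rw [Int.even_iff, Int.even_iff] at *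
    simp only [Pi.add_apply]
    omega

theorem redTerm_of_not_admissible (h : ¬ Admissible p w v m) : redTerm p w L v m = 0 := if_neg h

theorem redTerm_of_admissible (h : Admissible p w v m) : redTerm p w L v m =
    t ^ redExp p v m * ∏ j ∈ Finset.Icc 1 (p - 2), qBinom (top w L v m j - m j) (m j) := if_pos h

theorem admissible_of_redTerm_ne_zero (h : redTerm p w L v m ≠ 0) : Admissible p w v m := by
  by_contra h'
  exact h (if_neg h')

theorem nonneg_of_redTerm_ne_zero (h : redTerm p w L v m ≠ 0) (j : ℕ) : 0 ≤ m j := by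
  have hA := admissible_of_redTerm_ne_zero h
  by_cases hj : j = 0 ∨ p - 1 ≤ j
  · rw [hA.1 j hj]
  rw [redTerm_of_admissible hA] at h
  have := Finset.prod_ne_zero_iff.1 (right_ne_zero_of_mul h) j (Finset.mem_Icc.2 (by omega))
  exact (nonneg_of_qBinom_ne_zero this).2

theorem le_top_of_redTerm_ne_zero (h : redTerm p w L v m ≠ 0) {j : ℕ} (h1 : 1 ≤ j)
    (hj : j ≤ p - 2) : m j ≤ top w L v m j := by
  have hA := admissible_of_redTerm_ne_zero h
  rw [redTerm_of_admissible hA] at h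
  have := Finset.prod_ne_zero_iff.1 (right_ne_zero_of_mul h) j (Finset.mem_Icc.2 (by omega))
  linarith [(nonneg_of_qBinom_ne_zero this).1]

/-- On the support `m_1 ≤ L`, and `2 m_j ≤ m_{j-1} + m_{j+1} + U` for `2 ≤ j ≤ p - 2`. Since `m`
vanishes from `p - 1` on, induction from that end bounds every increment by a multiple of `U`. -/
theorem finite_support_redTerm (p : ℕ) (w : ℕ → ℤ) (L : ℤ) (v : ℕ → ℤ) :
    (Function.support (redTerm p w L v)).Finite := by
  obtain ⟨U, hU0, hU⟩ : ∃ U : ℤ, 0 ≤ U ∧ ∀ j < p, v j + w j ≤ U := by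
    refine ⟨∑ j ∈ Finset.range p, |v j + w j|, Finset.sum_nonneg fun j _ => abs_nonneg _,
      fun j hj => (le_abs_self _).trans ?_⟩
    exact Finset.single_le_sum (f := fun j => |v j + w j|) (fun j _ => abs_nonneg _)
      (Finset.mem_range.2 hj)
  have hb : ∀ m ∈ Function.support (redTerm p w L v), ∀ j, m j ≤ |L| + j * (p * U) := by
    intro m hm
    have h0 := (admissible_of_redTerm_ne_zero hm).1
    have hpos := nonneg_of_redTerm_ne_zero hm
    have hpU : 0 ≤ (p : ℤ) * U := by positivity
    have h1 : m 1 ≤ |L| := by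
      by_cases hp : 1 ≤ p - 2
      · have := le_top_of_redTerm_ne_zero hm le_rfl hp
        rw [top, if_pos rfl] at this
        exact this.trans (le_abs_self L)
      · rw [h0 1 (by omega)]
        exact abs_nonneg L
    have h4 : ∀ d i : ℕ, 1 ≤ i → p ≤ i + 1 + d → m (i + 1) ≤ m i + d * U := by
      intro d
      induction d with
      | zero =>
        intro i hi hd
        rw [h0 (i + 1) (by omega)]
        simpa using hpos i
      | succ d ih =>
        intro i hi hd
        have h2 := ih (i + 1) (by omega) (by omega)
        push_cast
        by_cases hip : i + 1 ≤ p - 2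
        · have h3 := le_top_of_redTerm_ne_zero hm (by omega) hip
          rw [top, if_neg (by omega), Nat.add_sub_cancel] at h3
          have := hU (i + 1) (by omega)
          have : 2 * m (i + 1) ≤ m i + m (i + 1 + 1) + U := by omega
          linarith
        · rw [h0 (i + 1) (by omega)]
          have := hpos i
          positivity
    intro j
    induction j with
    | zero =>
      rw [h0 0 (by simp)]
      positivity
    | succ j ih =>
      rcases Nat.eq_zero_or_pos j with rfl | hj
      · simp only [zero_add, Nat.cast_one, one_mul]
        linarith
      · have := h4 p j hj (by omega)
        push_cast
        linarith
  have hfin : (Set.univ.pi fun i : Fin (p - 1) =>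
      Set.Icc (0 : ℤ) (|L| + (i : ℕ) * (p * U))).Finite := Set.Finite.pi fun _ => Set.finite_Icc _ _
  refine (hfin.image fun (f : Fin (p - 1) → ℤ) (k : ℕ) =>
    if h : k < p - 1 then f ⟨k, h⟩ else 0).subset fun m hm => ?_
  refine ⟨fun i => m i, fun i _ => ⟨nonneg_of_redTerm_ne_zero hm _, hb m hm _⟩, ?_⟩
  funext k
  dsimp only
  split_ifs with h
  · rfl
  · exact ((admissible_of_redTerm_ne_zero hm).1 k (by omega)).symm

/-! ### Contiguity relations -/

theorem finsum_redTerm_sub (p : ℕ) (w : ℕ → ℤ) (L : ℤ) (v d : ℕ → ℤ) :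
    ∑ᶠ m, redTerm p w L v (m - d) = red p w L v :=
  finsum_comp_equiv (Equiv.subRight d)

/-- A linear relation between three reduced forms, deduced from one between their summands. -/
theorem red_eq_of_redTerm_eq {b c : RatFunc ℚ} {L' L'' : ℤ} (d : ℕ → ℤ)
    (h : ∀ m, redTerm p w L v m =
      b * redTerm p w L' v' m + c * redTerm p w L'' v'' (m - d)) :
    red p w L v = b * red p w L' v' + c * red p w L'' v'' := by
  rw [← finsum_redTerm_sub p w L'' v'' d, red, red, finsum_congr h, mul_finsum, mul_finsum,
    finsum_add_distrib]
  · exact (finite_support_redTerm p w L' v').subset fun m hm => right_ne_zero_of_mul hm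
  · refine ((finite_support_redTerm p w L'' v'').preimage
      (f := fun m => m - d) (sub_left_injective.injOn)).subset fun m hm => ?_
    exact right_ne_zero_of_mul hm

/-- Isolates the only binomial affected by the change of `v`. The level may change only when `j =
1`, since `L` enters no other binomial. -/
theorem redTerm_kron {L' c : ℤ} {j : ℕ} (h1 : 1 ≤ j) (hj : j ≤ p - 2) (hc : Even c)
    (hL : j ≠ 1 → L' = L) (h : ∀ i, 1 ≤ i → i ≤ p - 1 → v' i = v i + c * kron j i)
    (hA : Admissible p w v m) :
    redTerm p w L' v' m = t ^ (redExp p v m - 2 * c * m j) *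
      (qBinom (top w L' v' m j - m j) (m j) *
        ∏ i ∈ (Finset.Icc 1 (p - 2)).erase j, qBinom (top w L v m i - m i) (m i)) := by
  have hA' : Admissible p w v' m := by
    rw [admissible_congr fun i hi hi' => ?_]
    · exact hA
    · rw [h i hi hi', Int.even_add, iff_true_right (hc.mul_right _)]
  rw [redTerm_of_admissible hA', redExp_congr_add c j (hA.1 0 (by simp)) hj h1
    fun i hi hi' => h i hi (by omega), ← Finset.mul_prod_erase _ _ (Finset.mem_Icc.2 ⟨h1, hj⟩)]
  congr 2
  refine Finset.prod_congr rfl fun i hi => ?_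
  rw [Finset.mem_erase, Finset.mem_Icc] at hi
  congr 2
  unfold top
  split_ifs with h'
  · exact hL (by omega)
  · rw [h i (by omega) (by omega), kron, if_neg hi.1, mul_zero, add_zero]

/-- Lowering `m_j` by one and raising `v` at both neighbours cancel in the neighbouring upper
entries, so again only the `j`-th binomial changes. -/
theorem redTerm_nbr {L' : ℤ} {j : ℕ} (h1 : 1 ≤ j) (hj : j ≤ p - 2)
    (hL : j ≠ 1 → L' = L) (h : ∀ i, 1 ≤ i → i ≤ p - 1 → v' i = v i + nbr j i)
    (hA : Admissible p w v m) :
    redTerm p w L' v' (m - kron j) = t ^ (redExp p v m - 4 * m j + 2 + 2 * v j) *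
      (qBinom (top w L' v m j - m j + 1) (m j - 1) *
        ∏ i ∈ (Finset.Icc 1 (p - 2)).erase j, qBinom (top w L v m i - m i) (m i)) := by
  have hA' : Admissible p w v' (m - kron j) := by
    rw [admissible_add_kron j hj h1 fun i hi hi' => by rw [h i hi hi'], sub_add_cancel]
    exact hA
  have hk : ∀ i, i ≠ j → (m - kron j) i = m i := by
    intro i hi
    rw [Pi.sub_apply, kron, if_neg hi, sub_zero]
  have hkj : (m - kron j) j = m j - 1 := by
    rw [Pi.sub_apply, kron, if_pos rfl]
  have hE := redExp_add_kron (p := p) (v := v) (m := m - kron j) j hj h1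
  rw [sub_add_cancel, hkj, hk (j - 1) (by omega), hk (j + 1) (by omega)] at hE
  have hE' := redExp_nbr (v := v) j hA'.1 hj h1 fun i hi hi' => h i hi (by omega)
  rw [hk (j - 1) (by omega), hk (j + 1) (by omega)] at hE'
  rw [redTerm_of_admissible hA', ← Finset.mul_prod_erase _ _ (Finset.mem_Icc.2 ⟨h1, hj⟩),
    hkj, hE', hE]
  congr 2
  · ring
  · congr 1
    unfold top
    have hnj : nbr j j = 0 := if_neg (by omega)
    rw [hk (j - 1) (by omega), hk (j + 1) (by omega), h j h1 (by omega), hnj, add_zero]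
    ring
  refine Finset.prod_congr rfl fun i hi => ?_
  rw [Finset.mem_erase, Finset.mem_Icc] at hi
  rw [hk i hi.1]
  congr 2
  unfold top
  split_ifs with h'
  · exact hL (by omega)
  · rw [h i (by omega) (by omega)]
    simp only [nbr, kron, Pi.sub_apply]
    congr 1
    split_ifs <;> omega

/-- Contiguity in direction `j ≥ 2`. -/
theorem red_add_two {j : ℕ} (h2 : 2 ≤ j) (hj : j ≤ p - 2) (h0 : -1 ≤ v j + w j)
    (hv' : ∀ i, 1 ≤ i → i ≤ p - 1 → v' i = v i + 2 * kron j i)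
    (hv'' : ∀ i, 1 ≤ i → i ≤ p - 1 → v'' i = v i + nbr j i) :
    red p w L v' = red p w L v + t ^ (-2 * (1 + v j)) * red p w L v'' := by
  have hadm : ∀ m, Admissible p w v' m ↔ Admissible p w v m := fun m =>
    admissible_congr fun i hi hi' => by
      rw [hv' i hi hi', Int.even_add, iff_true_right (even_two.mul_right _)]
  rw [← one_mul (red p w L v)]
  refine red_eq_of_redTerm_eq (kron j) fun m => ?_
  by_cases hA : Admissible p w v m
  swap
  · rw [redTerm_of_not_admissible hA, redTerm_of_not_admissible (mt (hadm m).1 hA),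
      redTerm_of_not_admissible (p := p) (w := w) (v := v'')]
    · ring
    · rw [admissible_add_kron j hj (by omega) fun i hi hi' => by rw [hv'' i hi hi'],
        sub_add_cancel]
      exact hA
  rw [redTerm_kron (L := L) (v := v) (by omega) hj even_two (fun _ => rfl) hv' hA,
    redTerm_nbr (L := L) (v := v) (by omega) hj (fun _ => rfl) hv'' hA,
    redTerm_of_admissible hA, ← Finset.mul_prod_erase _ _ (Finset.mem_Icc.2 ⟨by omega, hj⟩)]
  set P := ∏ i ∈ (Finset.Icc 1 (p - 2)).erase j, qBinom (top w L v m i - m i) (m i) with hP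
  have e1 : t ^ redExp p v m = t ^ (redExp p v m - 2 * 2 * m j) * q ^ m j := by
    rw [q_zpow, ← zpow_add₀ t_ne_zero]; congr 1; ring
  have e2 : t ^ (-2 * (1 + v j)) * t ^ (redExp p v m - 4 * m j + 2 + 2 * v j) =
      t ^ (redExp p v m - 2 * 2 * m j) := by
    rw [← zpow_add₀ t_ne_zero]; congr 1; ring
  have htop : top w L v' m j = top w L v m j + 1 := by
    unfold top
    rw [if_neg (by omega), if_neg (by omega), hv' j (by omega) (by omega), kron, if_pos rfl]
    omega
  -- Pascal's rule needs a nonzero upper entry. A negative neighbour kills the other binomials.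
  -- Otherwise twice the old entry is even and at least `-1`, hence nonnegative, and the raised
  -- entry is positive.
  by_cases hneg : m (j - 1) < 0 ∨ m (j + 1) < 0
  · have hP0 : P = 0 := by
      rcases hneg with hn | hn
      · refine Finset.prod_eq_zero (i := j - 1) ?_ (qBinom_of_neg_right hn)
        rw [Finset.mem_erase, Finset.mem_Icc]
        omega
      · refine Finset.prod_eq_zero (i := j + 1) ?_ (qBinom_of_neg_right hn)
        rw [Finset.mem_erase, Finset.mem_Icc]
        have : ¬ (p - 1 ≤ j + 1) := fun h => by
          rw [hA.1 (j + 1) (Or.inr h)] at hn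
          exact lt_irrefl _ hn
        omega
    rw [hP0]
    ring
  · have hne : top w L v' m j - m j + m j ≠ 0 := by
      have := hA.2 j (by omega) (by omega)
      rw [htop, top, if_neg (by omega)]
      rw [Int.even_iff] at this
      omega
    have hpas := qBinom_pascal hne
    rw [htop, show top w L v m j + 1 - m j - 1 = top w L v m j - m j by ring,
      show top w L v m j + 1 - m j = top w L v m j - m j + 1 by ring] at hpas
    rw [htop, show top w L v m j + 1 - m j = top w L v m j - m j + 1 by ring, e1, hpas]
    linear_combination
      (-qBinom (top w L v m j - m j + 1) (m j - 1) * P) * e2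

/-- In direction `1` the upper entry is `L` whatever `v` is, so Pascal's rule gives way to
absorption, which turns `1 - q ^ m_1` into `1 - q ^ L` and lowers the level. -/
theorem red_add_two_sub {p : ℕ} (hp : 3 ≤ p) {w v v' v'' : ℕ → ℤ} {L : ℤ}
    (hv' : ∀ i, 1 ≤ i → i ≤ p - 1 → v' i = v i + 2 * kron 1 i)
    (hv'' : ∀ i, 1 ≤ i → i ≤ p - 1 → v'' i = v i + nbr 1 i) :
    red p w L v' = red p w L v + (1 - q ^ L) * t ^ (-2 * (1 + v 1)) * red p w (L - 1) v'' := by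
  have hadm : ∀ m, Admissible p w v' m ↔ Admissible p w v m := fun m =>
    admissible_congr fun i hi hi' => by
      rw [hv' i hi hi', Int.even_add, iff_true_right (even_two.mul_right _)]
  have h1p : 1 ≤ p - 2 := by omega
  rw [← one_mul (red p w L v)]
  refine red_eq_of_redTerm_eq (kron 1) fun m => ?_
  by_cases hA : Admissible p w v m
  swap
  · rw [redTerm_of_not_admissible hA, redTerm_of_not_admissible (mt (hadm m).1 hA),
      redTerm_of_not_admissible (p := p) (w := w) (v := v'')]
    · ring
    · rw [admissible_add_kron 1 h1p le_rfl fun i hi hi' => by rw [hv'' i hi hi'],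
        sub_add_cancel]
      exact hA
  rw [redTerm_kron (L := L) (v := v) le_rfl h1p even_two (fun _ => rfl) hv' hA,
    redTerm_nbr (L := L) (v := v) le_rfl h1p (fun h => absurd rfl h) hv'' hA,
    redTerm_of_admissible hA, ← Finset.mul_prod_erase _ _ (Finset.mem_Icc.2 ⟨le_rfl, h1p⟩)]
  set P := ∏ i ∈ (Finset.Icc 1 (p - 2)).erase 1, qBinom (top w L v m i - m i) (m i) with hP
  have e1 : t ^ redExp p v m = t ^ (redExp p v m - 2 * 2 * m 1) * q ^ m 1 := by
    rw [q_zpow, ← zpow_add₀ t_ne_zero]; congr 1; ring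
  have e2 : t ^ (-2 * (1 + v 1)) * t ^ (redExp p v m - 4 * m 1 + 2 + 2 * v 1) =
      t ^ (redExp p v m - 2 * 2 * m 1) := by
    rw [← zpow_add₀ t_ne_zero]; congr 1; ring
  simp only [top, if_true]
  have hb := one_sub_mul_qBinom (L - m 1) (m 1)
  rw [sub_add_cancel] at hb
  rw [show L - 1 - m 1 + 1 = L - m 1 by ring, e1]
  linear_combination (t ^ (redExp p v m - 2 * 2 * m 1) * P) * hb -
    ((1 - q ^ L) * qBinom (L - m 1) (m 1 - 1) * P) * e2

/-- The other absorption identity: adding `2e_1` to `v` multiplies a summand by `q ^ (-m_1)`, so the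
difference of the two level `L` terms carries the factor `1 - q ^ (L - m_1)`. -/
theorem red_eq_level {p : ℕ} (hp : 3 ≤ p) {w v v' : ℕ → ℤ} {L : ℤ}
    (hv' : ∀ i, 1 ≤ i → i ≤ p - 1 → v' i = v i + 2 * kron 1 i) :
    red p w L v = q ^ L * red p w L v' + (1 - q ^ L) * red p w (L - 1) v := by
  have hadm : ∀ m, Admissible p w v' m ↔ Admissible p w v m := fun m =>
    admissible_congr fun i hi hi' => by
      rw [hv' i hi hi', Int.even_add, iff_true_right (even_two.mul_right _)]
  have h1p : 1 ≤ p - 2 := by omega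
  refine red_eq_of_redTerm_eq 0 fun m => ?_
  rw [sub_zero]
  by_cases hA : Admissible p w v m
  swap
  · rw [redTerm_of_not_admissible hA, redTerm_of_not_admissible (mt (hadm m).1 hA),
      redTerm_of_not_admissible hA]
    ring
  rw [redTerm_kron (L := L) (v := v) le_rfl h1p even_two (fun _ => rfl) hv' hA,
    redTerm_kron (L := L) (v := v) (c := 0) (L' := L - 1) le_rfl h1p (by simp)
      (fun h => absurd rfl h) (by simp) hA,
    redTerm_of_admissible hA, ← Finset.mul_prod_erase _ _ (Finset.mem_Icc.2 ⟨le_rfl, h1p⟩)]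
  set P := ∏ i ∈ (Finset.Icc 1 (p - 2)).erase 1, qBinom (top w L v m i - m i) (m i) with hP
  have e1 : q ^ L * t ^ (redExp p v m - 2 * 2 * m 1) = t ^ redExp p v m * q ^ (L - m 1) := by
    rw [q_zpow, q_zpow, ← zpow_add₀ t_ne_zero, ← zpow_add₀ t_ne_zero]; congr 1; ring
  simp only [top, if_true]
  have hb := one_sub_mul_qBinom' (L - m 1) (m 1)
  rw [sub_add_cancel] at hb
  rw [show L - 1 - m 1 = L - m 1 - 1 by ring, mul_zero, zero_mul, sub_zero]
  linear_combination (t ^ redExp p v m * P) * hb - (qBinom (L - m 1) (m 1) * P) * e1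

/-- Eliminates `v + 2e_1` between `red_add_two_sub` and `red_eq_level`; what remains is divisible by
`1 - q ^ L`. -/
theorem red_level {p : ℕ} (hp : 3 ≤ p) {w v v' : ℕ → ℤ} {L : ℤ} (hL : L ≠ 0)
    (hv' : ∀ i, 1 ≤ i → i ≤ p - 1 → v' i = v i + nbr 1 i) :
    red p w L v = red p w (L - 1) v + t ^ (4 * L - 2 - 2 * v 1) * red p w (L - 1) v' := by
  have h1 := red_add_two_sub hp (w := w) (L := L) (v := v) (v' := fun i => v i + 2 * kron 1 i)
    (fun _ _ _ => rfl) hv'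
  have h2 := red_eq_level hp (w := w) (L := L) (v := v) (v' := fun i => v i + 2 * kron 1 i)
    (fun _ _ _ => rfl)
  apply mul_left_cancel₀ (one_sub_q_zpow_ne_zero hL)
  have h3 : t ^ (4 * L - 2 - 2 * v 1) = q ^ L * t ^ (-2 * (1 + v 1)) := by
    rw [q_zpow, ← zpow_add₀ t_ne_zero]; congr 1; ring
  rw [h3]
  linear_combination h2 + q ^ L * h1

/-- The same two relations, now eliminating `v` at level `L`. -/
theorem red_level' {p : ℕ} (hp : 3 ≤ p) {w v v' v'' : ℕ → ℤ} {L : ℤ} (hL : L ≠ 0)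
    (hv' : ∀ i, 1 ≤ i → i ≤ p - 1 → v' i = v i + 2 * kron 1 i)
    (hv'' : ∀ i, 1 ≤ i → i ≤ p - 1 → v'' i = v i + nbr 1 i) :
    red p w L v' = red p w (L - 1) v + t ^ (-2 * (1 + v 1)) * red p w (L - 1) v'' := by
  have h1 := red_add_two_sub hp (w := w) (L := L) hv' hv''
  have h2 := red_eq_level hp (w := w) (L := L) hv'
  apply mul_left_cancel₀ (one_sub_q_zpow_ne_zero hL)
  linear_combination h2 + h1

/-- The component of `v` at `p - 1` enters only through the last parity condition. -/
theorem red_congr (h : ∀ i, 1 ≤ i → i ≤ p - 2 → v' i = v i)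
    (h' : Even (v' (p - 1)) ↔ Even (v (p - 1))) : red p w L v' = red p w L v := by
  refine finsum_congr fun m => ?_
  have hA : Admissible p w v' m ↔ Admissible p w v m := admissible_congr fun i hi hi' => by
    rcases eq_or_ne i (p - 1) with rfl | hne
    · exact h'
    · rw [h i hi (by omega)]
  by_cases hm : Admissible p w v m
  swap
  · rw [redTerm_of_not_admissible hm, redTerm_of_not_admissible (mt hA.1 hm)]
  rw [redTerm_of_admissible hm, redTerm_of_admissible (hA.2 hm)]
  congr 1
  · congr 1
    refine Finset.sum_congr rfl fun i hi => ?_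
    rw [Finset.mem_range] at hi
    rcases Nat.eq_zero_or_pos i with rfl | hi0
    · rw [hm.1 0 (by simp)]; ring
    · rw [h i hi0 (by omega)]
  · refine Finset.prod_congr rfl fun i hi => ?_
    rw [Finset.mem_Icc] at hi
    simp only [top, h i hi.1 hi.2]

/-! ### Fusion of `e_2` and `e_b` -/

theorem red_fusion {p : ℕ} {w : ℕ → ℤ} (hw : ∀ i, 0 ≤ w i) (L x : ℤ) {b : ℕ} (hb : 3 ≤ b)
    (hbp : b ≤ p - 1) :
    red p w L (fun i => x * kron 1 i + kron 2 i + kron b i) +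
        red p w L (fun i => (x + 2) * kron 1 i - kron 2 i + kron b i) =
      red p w L (fun i => x * kron 1 i - kron 2 i + kron b i) +
        (if b + 1 = p then 0
          else t ^ (-2 : ℤ) * red p w L (fun i => (x + 1) * kron 1 i + kron (b + 1) i)) +
        red p w L (fun i => (x + 1) * kron 1 i + kron (b - 1) i) := by
  set P : ℕ → ℕ → ℤ := fun j i => (x + 1) * kron 1 i - kron j i + kron (j + 1) i + kron b i with hP
  set Q : ℕ → ℕ → ℤ := fun j i => (x + 1) * kron 1 i - kron j i - kron (j + 1) i + kron b i with hQ
  set R : ℕ → ℕ → ℤ := fun j i => (x + 1) * kron 1 i + kron j i - kron (j + 1) i + kron b i with hR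
  -- Contiguity from `Q j` in direction `j + 1` reads `P j = Q j + P (j + 1)`, and in direction `j`
  -- it reads `R j = Q j + R (j - 1)`. The coefficients are `1` because `Q j` is `-1` at both
  -- places. Hence `P j + R (j - 1)` does not depend on `j`.
  have htele : ∀ d, 3 + d ≤ b →
      red p w L (P 2) + red p w L (R 1) = red p w L (P (2 + d)) + red p w L (R (1 + d)) := by
    intro d
    induction d with
    | zero => intro _; rfl
    | succ d ih =>
      intro hd
      have hval : Q (2 + d) (3 + d) = -1 := by
        simp only [hQ, kron]; split_ifs <;> omega
      have hval' : Q (2 + d) (2 + d) = -1 := by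
        simp only [hQ, kron]; split_ifs <;> omega
      have h1 := red_add_two (p := p) (w := w) (L := L) (v := Q (2 + d)) (v' := P (2 + d))
        (v'' := P (3 + d)) (j := 3 + d) (by omega) (by omega) (by linarith [hw (3 + d)])
        (by intro i _ _; simp only [hP, hQ, kron]; split_ifs <;> omega)
        (by intro i _ _; simp only [hP, hQ, kron, nbr]; split_ifs <;> omega)
      have h2 := red_add_two (p := p) (w := w) (L := L) (v := Q (2 + d)) (v' := R (2 + d))
        (v'' := R (1 + d)) (j := 2 + d) (by omega) (by omega) (by linarith [hw (2 + d)])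
        (by intro i _ _; simp only [hR, hQ, kron]; split_ifs <;> omega)
        (by intro i _ _; simp only [hR, hQ, kron, nbr]; split_ifs <;> omega)
      rw [hval, add_neg_cancel, mul_zero, zpow_zero, one_mul] at h1
      rw [hval', add_neg_cancel, mul_zero, zpow_zero, one_mul] at h2
      rw [ih (by omega), h1, show 2 + (d + 1) = 3 + d by omega,
        show 1 + (d + 1) = 2 + d by omega, h2]
      ring
  have hstart := red_add_two (p := p) (w := w) (L := L)
    (v := fun i => x * kron 1 i - kron 2 i + kron b i)
    (v' := fun i => x * kron 1 i + kron 2 i + kron b i)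
    (v'' := P 2) (j := 2) (by omega) (by omega)
    (by have := hw 2; simp only [kron]; split_ifs <;> omega)
    (by intro i _ _; simp only [kron]; split_ifs <;> omega)
    (by intro i _ _; simp only [hP, kron, nbr]; split_ifs <;> omega)
  have hend := red_add_two (p := p) (w := w) (L := L)
    (v := fun i => (x + 1) * kron 1 i - kron (b - 1) i)
    (v' := fun i => (x + 1) * kron 1 i + kron (b - 1) i)
    (v'' := R (b - 2)) (j := b - 1) (by omega) (by omega)
    (by have := hw (b - 1); simp only [kron]; split_ifs <;> omega)
    (by intro i _ _; simp only [kron]; split_ifs <;> omega)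
    (by intro i _ _; simp only [hR, kron, nbr]; split_ifs <;> omega)
  -- Here `P (b - 1)` contains `2e_b`. For `b = p - 1` this is invisible to the reduced form, which
  -- accounts for the convention `F_p = 0`; otherwise contiguity in direction `b` yields `e_{b+1}`.
  have hclose : red p w L (P (b - 1)) =
      red p w L (fun i => (x + 1) * kron 1 i - kron (b - 1) i) + (if b + 1 = p then 0
          else t ^ (-2 : ℤ) * red p w L (fun i => (x + 1) * kron 1 i + kron (b + 1) i)) := by
    split_ifs with hbp'
    · rw [add_zero]
      refine red_congr (fun i _ _ => ?_) ?_
      · simp only [hP, kron]; split_ifs <;> omega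
      · simp only [hP, Int.even_iff, kron]; split_ifs <;> omega
    · have := red_add_two (p := p) (w := w) (L := L)
        (v := fun i => (x + 1) * kron 1 i - kron (b - 1) i) (v' := P (b - 1))
        (v'' := fun i => (x + 1) * kron 1 i + kron (b + 1) i) (j := b) (by omega) (by omega)
        (by have := hw b; simp only [kron]; split_ifs <;> omega)
        (by intro i _ _; simp only [hP, kron]; split_ifs <;> omega)
        (by intro i _ _; simp only [kron, nbr]; split_ifs <;> omega)
      rw [this]
      congr 3
      simp only [kron]; split_ifs <;> omega
  have hR1 : R 1 = fun i => (x + 2) * kron 1 i - kron 2 i + kron b i := by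
    funext i; simp only [hR]; ring
  have hx := htele (b - 3) (by omega)
  rw [show 2 + (b - 3) = b - 1 by omega, show 1 + (b - 3) = b - 2 by omega, hclose] at hx
  have hc1 : t ^ (-2 * (1 + (fun i => x * kron 1 i - kron 2 i + kron b i) 2) : ℤ) = 1 := by
    rw [show (-2 * (1 + (fun i => x * kron 1 i - kron 2 i + kron b i) 2) : ℤ) = 0 by
      simp only [kron]; split_ifs <;> omega, zpow_zero]
  have hc2 : t ^ (-2 * (1 + (fun i => (x + 1) * kron 1 i - kron (b - 1) i) (b - 1)) : ℤ) = 1 := by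
    rw [show (-2 * (1 + (fun i => (x + 1) * kron 1 i - kron (b - 1) i) (b - 1)) : ℤ) = 0 by
      simp only [kron]; split_ifs <;> omega, zpow_zero]
  rw [hc1] at hstart
  rw [hc2] at hend
  rw [← hR1]
  linear_combination hstart - hend + hx

/-! ### Recurrences for the reduced form -/

theorem one_div_sqrtq : 1 / sqrtq = t ^ (-2 : ℤ) := by
  rw [sqrtq, zpow_neg, one_div]; rfl

theorem q_zpow_div_sqrtq (L : ℤ) : q ^ L / sqrtq = t ^ (4 * L - 2) := by
  rw [q_zpow, zpow_sub₀ t_ne_zero]; rfl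

/-- The vector `x e_1 + e_b`. -/
def dirVec (x : ℤ) (b i : ℕ) : ℤ := x * kron 1 i + kron b i

theorem red_rel_one {p : ℕ} (hp : 4 ≤ p) {w : ℕ → ℤ} (x : ℤ) {L : ℤ} (hL : L ≠ 0) :
    red p w L (fun i => x * kron 1 i) = red p w (L - 1) (fun i => x * kron 1 i) +
      t ^ (4 * L - 2 - 2 * x) * red p w (L - 1) (dirVec x 2) := by
  rw [red_level (by omega) hL (v' := dirVec x 2)]
  · simp [kron]
  · intro i _ _; simp only [dirVec, kron, nbr]; split_ifs <;> omega

theorem red_rel_two_even {p : ℕ} (hp : 4 ≤ p) {w : ℕ → ℤ} (hw : ∀ i, 0 ≤ w i) {L : ℤ}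
    (hL : L ≠ 0) :
    red p w L (dirVec 0 2) = q ^ (L - 1) * red p w (L - 1) (dirVec 1 3) +
      q ^ L / sqrtq * red p w (L - 1) (fun i => 0 * kron 1 i) + red p w (L - 1) (dirVec 0 2) := by
  have h1 := red_level (p := p) (by omega) (w := w) hL (v := dirVec 0 2)
    (v' := fun i => 2 * kron 2 i)
    (by intro i _ _; simp only [dirVec, kron, nbr]; split_ifs <;> omega)
  have h2 := red_add_two (p := p) (w := w) (L := L - 1) (v := fun i => 0 * kron 1 i)
    (v' := fun i => 2 * kron 2 i) (v'' := dirVec 1 3) (j := 2) le_rfl (by omega)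
    (by have := hw 2; omega)
    (by intro i _ _; simp only [kron]; split_ifs <;> omega)
    (by intro i _ _; simp only [dirVec, kron, nbr]; split_ifs <;> omega)
  have e1 : t ^ (4 * L - 2 - 2 * dirVec 0 2 1) * t ^ (-2 * (1 + (fun i => 0 * kron 1 i) 2) : ℤ) =
      q ^ (L - 1) := by
    rw [q_zpow, ← zpow_add₀ t_ne_zero]
    congr 1
    simp [dirVec, kron]
    ring
  have e2 : t ^ (4 * L - 2 - 2 * dirVec 0 2 1) = t ^ (4 * L - 2) := by
    simp [dirVec, kron]
  rw [q_zpow_div_sqrtq, h1, h2, mul_add, ← mul_assoc, e1, e2]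
  ring

/-- Starting from `v = -e_1 + e_2`, the level `L - 2` contributions of `h3` and `h4` cancel. At
level `L - 1`, which may be zero, only the undivided relations are used. -/
theorem red_rel_two_odd {p : ℕ} (hp : 4 ≤ p) {w : ℕ → ℤ} (hw : ∀ i, 0 ≤ w i) {L : ℤ}
    (hL : L ≠ 0) :
    red p w L (dirVec 1 2) = 1 / sqrtq * red p w (L - 1) (dirVec 0 3) +
      red p w (L - 1) (fun i => 1 * kron 1 i) + q ^ (L - 1) * red p w (L - 1) (dirVec 1 2) := by
  have h1 := red_level' (p := p) (by omega) (w := w) hL (v := dirVec (-1) 2)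
    (v' := dirVec 1 2) (v'' := fun i => (-1) * kron 1 i + 2 * kron 2 i)
    (by intro i _ _; simp only [dirVec, kron]; split_ifs <;> omega)
    (by intro i _ _; simp only [dirVec, kron, nbr]; split_ifs <;> omega)
  have h2 := red_add_two (p := p) (w := w) (L := L - 1) (v := fun i => (-1) * kron 1 i)
    (v' := fun i => (-1) * kron 1 i + 2 * kron 2 i) (v'' := dirVec 0 3) (j := 2) le_rfl (by omega)
    (by have := hw 2; simp only [kron]; split_ifs <;> omega)
    (by intro i _ _; simp only [kron])
    (by intro i _ _; simp only [dirVec, kron, nbr]; split_ifs <;> omega)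
  have h3 := red_add_two_sub (p := p) (by omega) (w := w) (L := L - 1)
    (v := fun i => (-1) * kron 1 i) (v' := fun i => 1 * kron 1 i) (v'' := dirVec (-1) 2)
    (by intro i _ _; simp only [kron]; split_ifs <;> omega)
    (by intro i _ _; simp only [dirVec, kron, nbr]; split_ifs <;> omega)
  have h4 := red_eq_level (p := p) (by omega) (w := w) (L := L - 1)
    (v := dirVec (-1) 2) (v' := dirVec 1 2)
    (by intro i _ _; simp only [dirVec, kron]; split_ifs <;> omega)
  have z1 : -2 * (1 + dirVec (-1) 2 1) = 0 := by simp [dirVec, kron]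
  have z2 : (-2 * (1 + (fun i => (-1) * kron 1 i) 2) : ℤ) = -2 := by simp [kron]
  have z3 : (-2 * (1 + (fun i => (-1) * kron 1 i) 1) : ℤ) = 0 := by simp [kron]
  rw [z1, zpow_zero] at h1
  rw [z2] at h2
  rw [z3, zpow_zero] at h3
  rw [one_div_sqrtq]
  linear_combination h1 + h2 - h3 + h4

/-- Level lowering gives `e_2 + e_b`, which fusion resolves; the two leftover terms containing `-e_2
+ e_b` differ by `2e_1`, so `red_add_two_sub` turns them into `e_b` at level `L - 2`. -/
theorem red_rel_even {p : ℕ} (hp : 4 ≤ p) {w : ℕ → ℤ} (hw : ∀ i, 0 ≤ w i) {L : ℤ}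
    (hL : L ≠ 0) {b : ℕ} (hb : 3 ≤ b) (hbp : b ≤ p - 1) :
    red p w L (dirVec 0 b) =
      q ^ (L - 1) * (if b + 1 = p then 0 else red p w (L - 1) (dirVec 1 (b + 1)))
        + q ^ L / sqrtq * red p w (L - 1) (dirVec 1 (b - 1)) + red p w (L - 1) (dirVec 0 b)
        + q ^ (L - 1) * (q ^ (L - 1) - 1) * red p w (L - 2) (dirVec 0 b) := by
  have h1 := red_level (p := p) (by omega) (w := w) hL (v := dirVec 0 b)
    (v' := fun i => 0 * kron 1 i + kron 2 i + kron b i)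
    (by intro i _ _; simp only [dirVec, kron, nbr]; split_ifs <;> omega)
  have h2 := red_fusion hw (L - 1) 0 hb hbp
  have h3 := red_add_two_sub (p := p) (by omega) (w := w) (L := L - 1)
    (v := fun i => 0 * kron 1 i - kron 2 i + kron b i)
    (v' := fun i => (0 + 2) * kron 1 i - kron 2 i + kron b i) (v'' := dirVec 0 b)
    (by intro i _ _; simp only [kron]; split_ifs <;> omega)
    (by intro i _ _; simp only [dirVec, kron, nbr]; split_ifs <;> omega)
  rw [show L - 1 - 1 = L - 2 by ring] at h3
  have z1 : 4 * L - 2 - 2 * dirVec 0 b 1 = 4 * L - 2 := by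
    simp only [dirVec, kron]; split_ifs <;> omega
  have z2 : (-2 * (1 + (fun i => 0 * kron 1 i - kron 2 i + kron b i) 1) : ℤ) = -2 := by
    simp only [kron]; split_ifs <;> omega
  rw [z1] at h1
  rw [z2] at h3
  have e1 : q ^ (L - 1) = t ^ (4 * L - 2) * t ^ (-2 : ℤ) := by
    rw [q_zpow, ← zpow_add₀ t_ne_zero]; congr 1; ring
  change _ = _ + ite (b + 1 = p) 0 (t ^ (-2 : ℤ) * red p w (L - 1) (dirVec 1 (b + 1))) +
    red p w (L - 1) (dirVec 1 (b - 1)) at h2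
  have h4 : ∀ X : RatFunc ℚ, ite (b + 1 = p) 0 (t ^ (-2 : ℤ) * X) =
      t ^ (-2 : ℤ) * ite (b + 1 = p) 0 X := by
    intro X; split_ifs <;> simp
  rw [h4] at h2
  rw [q_zpow_div_sqrtq]
  linear_combination h1 + t ^ (4 * L - 2) * (h2 - h3) -
    (ite (b + 1 = p) 0 (red p w (L - 1) (dirVec 1 (b + 1))) +
      (q ^ (L - 1) - 1) * red p w (L - 2) (dirVec 0 b)) * e1

theorem red_rel_odd {p : ℕ} (hp : 4 ≤ p) {w : ℕ → ℤ} (hw : ∀ i, 0 ≤ w i) {L : ℤ}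
    (hL : L ≠ 0) {b : ℕ} (hb : 3 ≤ b) (hbp : b ≤ p - 1) :
    red p w L (dirVec 1 b) =
      1 / sqrtq * ((if b + 1 = p then 0 else red p w (L - 1) (dirVec 0 (b + 1)))
          + (q ^ (L - 1) - 1) * (if b + 1 = p then 0 else red p w (L - 2) (dirVec 0 (b + 1))))
        + (red p w (L - 1) (dirVec 0 (b - 1))
          + (q ^ (L - 1) - 1) * red p w (L - 2) (dirVec 0 (b - 1)))
        + (red p w (L - 1) (dirVec 1 b)
          + q ^ (L - 2) * (q ^ (L - 1) - 1) * red p w (L - 2) (dirVec 1 b)) := by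
  have h1 := red_level (p := p) (by omega) (w := w) hL (v := dirVec 1 b)
    (v' := fun i => 1 * kron 1 i + kron 2 i + kron b i)
    (by intro i _ _; simp only [dirVec, kron, nbr]; split_ifs <;> omega)
  have h2 := red_fusion hw (L - 1) 1 hb hbp
  have h3 := red_add_two_sub (p := p) (by omega) (w := w) (L := L - 1)
    (v := fun i => 1 * kron 1 i - kron 2 i + kron b i)
    (v' := fun i => (1 + 2) * kron 1 i - kron 2 i + kron b i) (v'' := dirVec 1 b)
    (by intro i _ _; simp only [kron]; split_ifs <;> omega)
    (by intro i _ _; simp only [dirVec, kron, nbr]; split_ifs <;> omega)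
  -- Fusion with `x = 1` produces `2e_1 + e_{b±1}`; this trades them for `e_{b±1}` at levels `L - 1`
  -- and `L - 2`.
  have h5 : ∀ c, red p w (L - 1) (dirVec 0 c) =
      q ^ (L - 1) * red p w (L - 1) (dirVec 2 c) +
        (1 - q ^ (L - 1)) * red p w (L - 2) (dirVec 0 c) := fun c => by
    have := red_eq_level (p := p) (by omega) (w := w) (L := L - 1)
      (v := dirVec 0 c) (v' := dirVec 2 c)
      (by intro i _ _; simp only [dirVec, kron]; split_ifs <;> omega)
    rwa [show L - 1 - 1 = L - 2 by ring] at this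
  rw [show L - 1 - 1 = L - 2 by ring] at h3
  have z1 : 4 * L - 2 - 2 * dirVec 1 b 1 = 4 * (L - 1) := by
    simp only [dirVec, kron]; split_ifs <;> omega
  have z2 : (-2 * (1 + (fun i => 1 * kron 1 i - kron 2 i + kron b i) 1) : ℤ) = -4 := by
    simp only [kron]; split_ifs <;> omega
  rw [z1, ← q_zpow] at h1
  rw [z2] at h3
  have e1 : q ^ (L - 2) = q ^ (L - 1) * t ^ (-4 : ℤ) := by
    rw [q_zpow, q_zpow, ← zpow_add₀ t_ne_zero]; congr 1; ring
  change _ = _ + ite (b + 1 = p) 0 (t ^ (-2 : ℤ) * red p w (L - 1) (dirVec 2 (b + 1))) +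
    red p w (L - 1) (dirVec 2 (b - 1)) at h2
  rw [one_div_sqrtq, e1]
  split_ifs at h2 ⊢
  · linear_combination h1 + q ^ (L - 1) * (h2 - h3) - h5 (b - 1)
  · linear_combination h1 + q ^ (L - 1) * (h2 - h3) - h5 (b - 1) - t ^ (-2 : ℤ) * h5 (b + 1)

/-! ### From the fermionic form to the reduced form -/

theorem qBinom_ne_zero {n m : ℤ} (hn : 0 ≤ n) (hm : 0 ≤ m) : qBinom n m ≠ 0 := by
  rw [qBinom, if_pos ⟨hn, hm⟩]
  exact div_ne_zero (qPochhammer_ne_zero _)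
    (mul_ne_zero (qPochhammer_ne_zero _) (qPochhammer_ne_zero _))

/-- The vector `θ(a > 1) e_a`. -/
def bigUnit (a i : ℕ) : ℤ := if 1 < a then kron a i else 0

theorem bigUnit_nonneg (a i : ℕ) : 0 ≤ bigUnit a i := by
  simp only [bigUnit, kron]; split_ifs <;> omega

theorem bigUnit_one (a : ℕ) : bigUnit a 1 = 0 := by
  simp only [bigUnit, kron]; split_ifs <;> omega

theorem bigUnit_zero (a : ℕ) : bigUnit a 0 = 0 := by
  simp only [bigUnit, kron]; split_ifs <;> omega

/-- The vector `A_{a,b}`, where `x` is the parity `π`. -/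
def aSeq (x : ℤ) (b i : ℕ) : ℤ := x * kron 1 i + bigUnit b i

theorem aSeq_one (x : ℤ) (b : ℕ) : aSeq x b 1 = x := by
  simp [aSeq, bigUnit_one, kron]

theorem aSeq_zero (x : ℤ) (b : ℕ) : aSeq x b 0 = 0 := by
  simp [aSeq, bigUnit_zero, kron]

/-- The component `n_0` of a nonvanishing summand of the reduced form, completed to a summand of
the fermionic form, is nonnegative. -/
theorem le_two_mul_of_redTerm_ne_zero {p a b : ℕ} (hp : 4 ≤ p) (hap : a ≤ p - 2)
    {x L : ℤ} (hx0 : 0 ≤ x) (hx1 : x ≤ 1) {m : ℕ → ℤ}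
    (hm : redTerm p (bigUnit a) L (aSeq x b) m ≠ 0) : m 2 + x ≤ 2 * L := by
  by_contra! hlt
  have hA := admissible_of_redTerm_ne_zero hm
  have hpos := nonneg_of_redTerm_ne_zero hm
  have h1 := le_top_of_redTerm_ne_zero hm le_rfl (by omega : 1 ≤ p - 2)
  rw [top, if_pos rfl] at h1
  have h2 := hA.2 1 le_rfl (by omega)
  rw [aSeq_one, bigUnit_one, Int.even_iff] at h2
  simp only [Nat.sub_self, Nat.reduceAdd, hA.1 0 (Or.inl rfl)] at h2
  -- On the support `m` is convex beyond `1`, except that its slope may drop by one at `a` and at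
  -- `b`; `c j` counts these drops up to `j`. The assumption to be refuted makes the initial slope
  -- `m_2 - m_1` at least `1`.
  set c : ℕ → ℤ := fun j =>
    (if 1 < a ∧ a ≤ j then 1 else 0) + (if 1 < b ∧ b ≤ j then 1 else 0) with hc
  have hslope : ∀ j, 1 ≤ j → j ≤ p - 2 → m 2 - m 1 - c j ≤ m (j + 1) - m j ∧
      (m (j + 1) - m j - (m 2 - m 1) + c j) % 2 = 0 := by
    intro j hj
    induction j, hj using Nat.le_induction with
    | base =>
      intro _
      have : c 1 = 0 := by simp only [hc]; split_ifs <;> omega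
      simp only [Nat.reduceAdd]
      omega
    | succ j hj ih =>
      intro hjp
      have h3 := ih (by omega)
      have h4 := le_top_of_redTerm_ne_zero hm (by omega) hjp
      have h5 := hA.2 (j + 1) (by omega) (by omega)
      rw [top, if_neg (by omega)] at h4
      rw [Int.even_iff] at h5
      rw [Nat.add_sub_cancel] at h4 h5
      have h6 : c (j + 1) = c j + (aSeq x b (j + 1) + bigUnit a (j + 1)) := by
        simp only [hc, aSeq, bigUnit, kron]
        split_ifs <;> omega
      omega
  have hmono : (∀ j, 2 ≤ j → j ≤ p - 2 → 0 ≤ m (j + 1) - m j) → m 2 ≤ 0 := by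
    intro h
    have : ∀ d, 2 + d ≤ p - 1 → m 2 ≤ m (2 + d) := by
      intro d
      induction d with
      | zero => intro _; rfl
      | succ d ih =>
        intro hd
        have h3 := ih (by omega)
        have h4 := h (2 + d) (by omega) (by omega)
        rw [← add_assoc]
        linarith
    have h3 := this (p - 3) (by omega)
    rwa [hA.1 (2 + (p - 3)) (by omega)] at h3
  have hm1 := hpos 1
  -- Only here can the slope become negative: initial slope `1` and two drops. Then the slope parity
  -- makes `m_{p-2}` odd, against the last admissibility condition. Otherwise `m` is nondecreasing
  -- from `2` to `p - 1`, where it vanishes, although `m_2 > 0`.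
  by_cases hs : m 2 - m 1 = 1 ∧ 1 < a ∧ 1 < b ∧ b ≤ p - 2
  · have h3 := (hslope (p - 2) (by omega) le_rfl).2
    have h4 := hA.2 (p - 1) (by omega) le_rfl
    have h5 : c (p - 2) = 2 := by
      simp only [hc]; split_ifs <;> omega
    have h6 : aSeq x b (p - 1) + bigUnit a (p - 1) = 0 := by
      simp only [aSeq, bigUnit, kron]
      split_ifs <;> omega
    rw [show p - 2 + 1 = p - 1 by omega, hA.1 (p - 1) (by omega)] at h3
    rw [show p - 1 - 1 = p - 2 by omega, hA.1 (p - 1 + 1) (by omega), Int.even_iff] at h4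
    omega
  · have := hmono fun j hj hjp => by
      have h3 := (hslope j (by omega) hjp).1
      have h5 : c j ≤ 2 := by simp only [hc]; split_ifs <;> omega
      by_cases h6 : m 2 - m 1 = 1
      · have h7 : c j ≤ 1 := by
          simp only [hc]; split_ifs <;> omega
        omega
      · omega
    omega

open Classical in
/-- A summand of the fermionic form, in terms of `m` with `m_0` and `m_1` replaced by their sum,
and of `m_1 = i`. -/
noncomputable def fullTerm (p : ℕ) (w : ℕ → ℤ) (L x : ℤ) (v : ℕ → ℤ) (y : (ℕ → ℤ) × ℤ) :
    RatFunc ℚ :=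
  if Admissible p w v y.1 then
    t ^ redExp p v y.1 * (∏ j ∈ Finset.Ico 2 (p - 1), qBinom (top w L v y.1 j - y.1 j) (y.1 j)) *
      (q ^ ((y.1 1 - y.2) * ((y.1 2 + x) / 2 - y.2)) * qBinom ((y.1 2 + x) / 2 - y.2) y.2 *
        qBinom (L - (y.1 2 + x) / 2 - (y.1 1 - y.2)) (y.1 1 - y.2))
  else 0

theorem redTerm_eq_mul_prod {p : ℕ} (hp : 4 ≤ p) {w : ℕ → ℤ} {L : ℤ} {v m : ℕ → ℤ}
    (hA : Admissible p w v m) : redTerm p w L v m =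
      t ^ redExp p v m * (∏ j ∈ Finset.Ico 2 (p - 1), qBinom (top w L v m j - m j) (m j)) *
        qBinom (L - m 1) (m 1) := by
  have : Finset.Icc 1 (p - 2) = Finset.Ico 1 (p - 1) := by
    ext j; simp only [Finset.mem_Icc, Finset.mem_Ico]; omega
  rw [redTerm_of_admissible hA, this, Finset.prod_eq_prod_Ico_succ_bot (by omega), mul_assoc,
    mul_comm (qBinom _ _)]
  rfl

theorem finsum_fullTerm {p a b : ℕ} (hp : 4 ≤ p) (hap : a ≤ p - 2)
    {x : ℤ} (L : ℤ) (hx0 : 0 ≤ x) (hx1 : x ≤ 1) :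
    ∑ᶠ y, fullTerm p (bigUnit a) L x (aSeq x b) y = red p (bigUnit a) L (aSeq x b) := by
  rw [finsum_curry]
  · refine finsum_congr fun m => ?_
    by_cases hA : Admissible p (bigUnit a) (aSeq x b) m
    swap
    · simp only [fullTerm, hA, if_false, finsum_zero, redTerm_of_not_admissible hA]
    simp only [fullTerm, hA, if_true]
    rw [← mul_finsum]
    -- If an upper entry is negative, Vandermonde is unavailable, but both sides vanish.
    by_cases hN : 0 ≤ (m 2 + x) / 2 ∧ 0 ≤ L - (m 2 + x) / 2
    · rw [finsum_qBinom_mul_qBinom _ _ _ hN.2 hN.1, redTerm_eq_mul_prod hp hA, sub_add_cancel]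
    · rw [finsum_eq_zero_of_forall_eq_zero, mul_zero, eq_comm]
      · by_contra h
        have h2 := nonneg_of_redTerm_ne_zero h 2
        have := le_two_mul_of_redTerm_ne_zero hp hap hx0 hx1 h
        omega
      · intro i
        by_contra h
        have h1 := nonneg_of_qBinom_ne_zero (right_ne_zero_of_mul h)
        have h2 := nonneg_of_qBinom_ne_zero (right_ne_zero_of_mul (left_ne_zero_of_mul h))
        omega
  · refine ((finite_support_redTerm p (bigUnit a) L (aSeq x b)).prod
      (Set.finite_Icc (0 : ℤ) L)).subset ?_
    rintro ⟨m, i⟩ h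
    rw [Function.mem_support, fullTerm] at h
    dsimp only at h
    split_ifs at h with hA
    swap
    · exact absurd rfl h
    have h0 := right_ne_zero_of_mul h
    have h1 := nonneg_of_qBinom_ne_zero (right_ne_zero_of_mul h0)
    have h2 := nonneg_of_qBinom_ne_zero (right_ne_zero_of_mul (left_ne_zero_of_mul h0))
    refine ⟨?_, Set.mem_Icc.2 (by omega)⟩
    change redTerm _ _ _ _ _ ≠ 0
    rw [redTerm_eq_mul_prod hp hA]
    exact mul_ne_zero (left_ne_zero_of_mul h) (qBinom_ne_zero (by omega) (by omega))

/-- The vector `m` of the fermionic form with `m_1 = i` and given `m_0 + m_1`. -/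
def splitSeq (y : (ℕ → ℤ) × ℤ) (j : ℕ) : ℤ :=
  if j = 0 then y.1 1 - y.2 else if j = 1 then y.2 else y.1 j

/-- Twice the components of `n + m`. -/
def doubleTop (w : ℕ → ℤ) (L x : ℤ) (v m : ℕ → ℤ) (j : ℕ) : ℤ :=
  if j = 0 then 2 * L - m 2 - x else m (j - 1) + m (j + 1) + v j + w j

/-- The solution of the system determined by `m`. -/
def toPair (p : ℕ) (w : ℕ → ℤ) (L x : ℤ) (v : ℕ → ℤ) (y : (ℕ → ℤ) × ℤ) : Vec p × Vec p :=
  (fun j => doubleTop w L x v y.1 j / 2 - splitSeq y j, fun j => splitSeq y j)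

theorem ext_apply_fin {p : ℕ} (M : Vec p) (j : Fin (p - 1)) : ext M j = M j := by
  simp [ext]

theorem ext_of_le {p : ℕ} (M : Vec p) {j : ℕ} (h : p - 1 ≤ j) : ext M j = 0 :=
  dif_neg (by omega)

theorem incidence_mulVec_splitSeq {p : ℕ} (hp : 4 ≤ p) {y : (ℕ → ℤ) × ℤ}
    (h0 : ∀ j, j = 0 ∨ p - 1 ≤ j → y.1 j = 0) (j : Fin (p - 1)) :
    (incidence p *ᵥ fun j : Fin (p - 1) => splitSeq y j) j =
      if (j : ℕ) = 0 then -y.1 2 else y.1 (j - 1) + y.1 (j + 1) := by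
  have hext : ∀ k, ext (p := p) (fun j : Fin (p - 1) => splitSeq y j) k = splitSeq y k := by
    intro k
    unfold ext
    split_ifs with hk
    · rfl
    · rw [splitSeq, if_neg (by omega), if_neg (by omega), h0 k (by omega)]
  have h00 := h0 0 (Or.inl rfl)
  rw [incidence_mulVec hp]
  simp only [hext]
  obtain ⟨j, hj⟩ := j
  dsimp only
  rcases j with _ | _ | _ | j
  · simp [splitSeq]
  · simp [splitSeq, h00]
  · simp [splitSeq]; ring
  · simp [splitSeq]

theorem uVec_apply {p a b : ℕ} {x : ℤ} (hx : parity p 0 a b = x) (j : Fin (p - 1)) :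
    uVec p 0 a b j = bigUnit a j + bigUnit b j + x * (kron 1 j - kron 0 j) := by
  subst hx
  simp only [uVec, bigUnit, kron, Pi.add_apply, Pi.smul_apply, Pi.sub_apply, smul_eq_mul]
  congr 2 <;> split_ifs <;> simp_all [e]

theorem aVec_apply {p a b : ℕ} {x : ℤ} (hx : parity p 0 a b = x) (j : Fin (p - 1)) :
    aVec p 0 a b j = aSeq x b j := by
  subst hx
  simp only [aVec, aSeq, bigUnit, kron, Pi.add_apply, Pi.smul_apply, smul_eq_mul]
  rw [add_comm]
  congr 1
  split_ifs <;> simp_all [e]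

theorem toPair_snd_mem_nmSystem_iff {p a b : ℕ} (hp : 4 ≤ p) {x k : ℤ} (L : ℤ)
    (hx : parity p 0 a b = x) {y : (ℕ → ℤ) × ℤ}
    (h0 : ∀ j, j = 0 ∨ p - 1 ≤ j → y.1 j = 0) (n : Vec p) :
    (n, fun j : Fin (p - 1) => splitSeq y j) ∈ nmSystem p k L (uVec p 0 a b) ↔
      (∀ j : Fin (p - 1),
        2 * (n j + splitSeq y j) = doubleTop (bigUnit a) L x (aSeq x b) y.1 j) ∧
      y.1 (p - 2) ≡ k [ZMOD 2] := by
  refine and_congr ?_ ?_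
  · rw [funext_iff]
    refine forall_congr' fun j => ?_
    simp only [Pi.add_apply, Pi.smul_apply, smul_eq_mul, incidence_mulVec_splitSeq hp h0,
      uVec_apply hx, doubleTop, aSeq, e]
    obtain ⟨j, hj⟩ := j
    dsimp only
    rcases eq_or_ne j 0 with rfl | hj0
    · simp [bigUnit_zero, kron, sub_eq_add_neg, add_comm]
    · simp only [hj0, if_false, kron]
      rw [show y.1 (j - 1) + y.1 (j + 1) + 2 * L * 0 + (bigUnit a j + bigUnit b j +
        x * ((if j = 1 then 1 else 0) - 0)) = y.1 (j - 1) + y.1 (j + 1) +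
          (x * (if j = 1 then 1 else 0) + bigUnit b j) + bigUnit a j by ring]
  · have : splitSeq y (p - 2) = y.1 (p - 2) := by
      rw [splitSeq, if_neg (by omega), if_neg (by omega)]
    rw [← this]
    constructor
    · intro h; exact h ⟨p - 2, by omega⟩ rfl
    · rintro h ⟨j, hj⟩ (rfl : j = p - 2); exact h

theorem bijOn_toPair {p a b : ℕ} (hp : 4 ≤ p) (hap : a ≤ p - 2) {x : ℤ} (L : ℤ)
    (hx : parity p 0 a b = x) :
    Set.BijOn (toPair p (bigUnit a) L x (aSeq x b))
      {y | Admissible p (bigUnit a) (aSeq x b) y.1}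
      (nmSystem p (if b = p - 1 then 1 else 0) L (uVec p 0 a b)) := by
  -- Admissibility at `p - 1` thereby encodes the prescribed parity of `m_{p-2}`.
  have hlast : aSeq x b (p - 1) + bigUnit a (p - 1) = if b = p - 1 then 1 else 0 := by
    simp only [aSeq, bigUnit, kron]
    split_ifs <;> omega
  refine ⟨?_, ?_, ?_⟩
  · rintro ⟨m, i⟩ hA
    have hA : Admissible p (bigUnit a) (aSeq x b) m := hA
    refine (toPair_snd_mem_nmSystem_iff hp L hx hA.1 _).2 ⟨fun j => ?_, ?_⟩
    · have hev : doubleTop (bigUnit a) L x (aSeq x b) m j % 2 = 0 := by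
        unfold doubleTop
        split_ifs with hj
        · have := hA.2 1 le_rfl (by omega)
          rw [aSeq_one, bigUnit_one, Int.even_iff] at this
          simp only [Nat.sub_self, Nat.reduceAdd, hA.1 0 (Or.inl rfl)] at this
          omega
        · exact Int.even_iff.1 (hA.2 j (by omega) j.2.le)
      simp only
      omega
    · have := hA.2 (p - 1) (by omega) le_rfl
      rw [hA.1 (p - 1 + 1) (by omega), Int.even_iff, show p - 1 - 1 = p - 2 by omega] at this
      dsimp only
      rw [Int.ModEq]
      omega
  · rintro ⟨m, i⟩ hA ⟨m', i'⟩ hA' h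
    have hA : Admissible p (bigUnit a) (aSeq x b) m := hA
    have hA' : Admissible p (bigUnit a) (aSeq x b) m' := hA'
    have hs : ∀ j, j < p - 1 → splitSeq (m, i) j = splitSeq (m', i') j := fun j hj =>
      congrFun (congrArg Prod.snd h) ⟨j, hj⟩
    have h0 := hs 0 (by omega)
    have h1 := hs 1 (by omega)
    simp only [splitSeq, if_true, one_ne_zero, if_false] at h0 h1
    refine Prod.ext (funext fun j => ?_) h1
    dsimp only
    by_cases hj : j = 0 ∨ p - 1 ≤ j
    · rw [hA.1 j hj, hA'.1 j hj]
    · by_cases hj1 : j = 1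
      · subst hj1
        omega
      · have := hs j (by omega)
        simp only [splitSeq] at this
        rwa [if_neg (by omega), if_neg hj1, if_neg (by omega), if_neg hj1] at this
  · rintro ⟨n, M⟩ hnM
    set m : ℕ → ℤ := fun j => if j = 0 then 0 else if j = 1 then ext M 0 + ext M 1 else ext M j
      with hmdef
    have h0 : ∀ j, j = 0 ∨ p - 1 ≤ j → m j = 0 := by
      intro j hj
      simp only [hmdef]
      split_ifs with h h'
      · rfl
      · omega
      · exact ext_of_le M (by omega)
    have hM : (fun j : Fin (p - 1) => splitSeq (m, ext M 1) j) = M := by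
      funext j
      rw [← ext_apply_fin M j]
      simp only [splitSeq, hmdef, one_ne_zero, if_false, if_true]
      split_ifs with h h'
      · rw [h]; ring
      · rw [h']
      · rfl
    rw [← hM] at hnM
    have hsys := (toPair_snd_mem_nmSystem_iff (y := (m, ext M 1)) hp L hx h0 n).1 hnM
    refine ⟨(m, ext M 1), ⟨h0, fun j hj1 hj => ?_⟩, Prod.ext (funext fun j => ?_) hM⟩
    · dsimp only
      rcases eq_or_ne j (p - 1) with rfl | hjne
      · have := hsys.2
        dsimp only at this
        rw [Int.ModEq] at this
        rw [h0 (p - 1 + 1) (by omega), Int.even_iff, show p - 1 - 1 = p - 2 by omega]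
        omega
      · have := hsys.1 ⟨j, by omega⟩
        simp only [doubleTop] at this
        rw [if_neg (by omega)] at this
        rw [← this]
        exact even_two_mul _
    · have := hsys.1 j
      simp only [toPair] at this ⊢
      omega

/-- In terms of `m_0 + m_1` and `m_1`, the quadratic form separates into the reduced exponent and
exactly the weight of the `q`-Vandermonde sum. -/
theorem sum_splitSeq {p b : ℕ} (hp : 4 ≤ p) {x : ℤ} {y : (ℕ → ℤ) × ℤ}
    (h0 : ∀ j, j = 0 ∨ p - 1 ≤ j → y.1 j = 0) (hx : Even (y.1 2 + x)) :
    ∑ j ∈ Finset.range (p - 1), splitSeq y j * (2 * splitSeq y j -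
        (if j = 0 then -y.1 2 else y.1 (j - 1) + y.1 (j + 1)) - 2 * aSeq x b j) =
      redExp p (aSeq x b) y.1 + 4 * ((y.1 1 - y.2) * ((y.1 2 + x) / 2 - y.2)) := by
  obtain ⟨m, i⟩ := y
  obtain ⟨c, hc⟩ := hx
  dsimp only at *
  -- Truncating at `n` leaves the boundary term `m (n - 1) * m n`, which disappears at `n = p - 1`.
  have key : ∀ n, 2 ≤ n →
      ∑ j ∈ Finset.range n, splitSeq (m, i) j * (2 * splitSeq (m, i) j -
        (if j = 0 then -m 2 else m (j - 1) + m (j + 1)) - 2 * aSeq x b j) =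
      ∑ j ∈ Finset.range n, 2 * (m j * (m j - m (j + 1) - aSeq x b j)) +
        4 * ((m 1 - i) * (c - i)) + m (n - 1) * m n := by
    intro n hn
    induction n, hn using Nat.le_induction with
    | base =>
      have hx' : x = 2 * c - m 2 := by omega
      simp [Finset.sum_range_succ, splitSeq, aSeq_zero, aSeq_one, h0 0 (Or.inl rfl), hx']
      ring
    | succ n hn ih =>
      rw [Finset.sum_range_succ, ih, Finset.sum_range_succ]
      simp only [splitSeq]
      rw [if_neg (by omega), if_neg (by omega), if_neg (by omega), Nat.add_sub_cancel]
      ring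
  rw [key (p - 1) (by omega), h0 (p - 1) (by omega), redExp, hc, show (c + c) / 2 = c by omega]
  ring

theorem summand_toPair {p a b : ℕ} (hp : 4 ≤ p) {x : ℤ} (L : ℤ)
    (hx : parity p 0 a b = x) {y : (ℕ → ℤ) × ℤ}
    (hA : Admissible p (bigUnit a) (aSeq x b) y.1) :
    summand p (aVec p 0 a b) (toPair p (bigUnit a) L x (aSeq x b) y) =
      fullTerm p (bigUnit a) L x (aSeq x b) y := by
  have hev := hA.2 1 le_rfl (by omega)
  rw [aSeq_one, bigUnit_one, Nat.sub_self, hA.1 0 (Or.inl rfl), zero_add, add_zero] at hev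
  have hexp : (toPair p (bigUnit a) L x (aSeq x b) y).2 ⬝ᵥ
        (cartan p *ᵥ (toPair p (bigUnit a) L x (aSeq x b) y).2) -
      2 * (aVec p 0 a b ⬝ᵥ (toPair p (bigUnit a) L x (aSeq x b) y).2) =
      redExp p (aSeq x b) y.1 + 4 * ((y.1 1 - y.2) * ((y.1 2 + x) / 2 - y.2)) := by
    rw [← sum_splitSeq hp hA.1 hev, ← Fin.sum_univ_eq_sum_range (fun j =>
      splitSeq y j * (2 * splitSeq y j -
        (if j = 0 then -y.1 2 else y.1 (j - 1) + y.1 (j + 1)) - 2 * aSeq x b j)),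
      dotProduct, dotProduct, Finset.mul_sum, ← Finset.sum_sub_distrib]
    refine Finset.sum_congr rfl fun j _ => ?_
    have h2 : ((2 : Matrix (Fin (p - 1)) (Fin (p - 1)) ℤ) *ᵥ
        fun j : Fin (p - 1) => splitSeq y j) j = 2 * splitSeq y j := by
      rw [show (2 : Matrix (Fin (p - 1)) (Fin (p - 1)) ℤ) = 1 + 1 from one_add_one_eq_two.symm,
        Matrix.add_mulVec, Matrix.one_mulVec, Pi.add_apply]
      ring
    simp only [toPair, cartan, Matrix.sub_mulVec, Pi.sub_apply, h2,
      incidence_mulVec_splitSeq hp hA.1, aVec_apply hx]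
    ring
  have hprod : ∏ j, qBinom ((toPair p (bigUnit a) L x (aSeq x b) y).1 j)
        ((toPair p (bigUnit a) L x (aSeq x b) y).2 j) =
      (qBinom ((y.1 2 + x) / 2 - y.2) y.2 *
        qBinom (L - (y.1 2 + x) / 2 - (y.1 1 - y.2)) (y.1 1 - y.2)) *
      ∏ j ∈ Finset.Ico 2 (p - 1),
        qBinom (top (bigUnit a) L (aSeq x b) y.1 j - y.1 j) (y.1 j) := by
    simp only [toPair]
    rw [Fin.prod_univ_eq_prod_range (fun j =>
      qBinom (doubleTop (bigUnit a) L x (aSeq x b) y.1 j / 2 - splitSeq y j) (splitSeq y j)),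
      ← Finset.prod_range_mul_prod_Ico _ (by omega : 2 ≤ p - 1)]
    congr 1
    · rw [Finset.prod_range_succ, Finset.prod_range_one, mul_comm]
      congr 1
      · simp [doubleTop, splitSeq, hA.1 0 (Or.inl rfl), aSeq_one, bigUnit_one]
      · simp only [doubleTop, splitSeq, if_true]
        congr 1
        rw [show 1 + 1 = 2 from rfl, Int.even_iff] at hev
        omega
    · refine Finset.prod_congr rfl fun j hj => ?_
      rw [Finset.mem_Ico] at hj
      have h0 : j ≠ 0 := by omega
      have h1 : j ≠ 1 := by omega
      simp only [doubleTop, splitSeq, top, h0, h1, if_false]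
  rw [summand, hexp, hprod, fullTerm, if_pos hA, zpow_add₀ t_ne_zero, ← q_zpow]
  ring

theorem F_eq_red {p a b : ℕ} (hp : 4 ≤ p) (hap : a ≤ p - 2) (hb : b ≤ p - 1) {x : ℤ}
    (hx : parity p 0 a b = x) (L : ℤ) : F p 0 a b L = red p (bigUnit a) L (aSeq x b) := by
  have hF : F p 0 a b L =
      fermForm p (if b = p - 1 then 1 else 0) L (uVec p 0 a b) (aVec p 0 a b) := by
    rw [F, if_neg (by omega)]
    split_ifs <;> simp
  have hx01 : 0 ≤ x ∧ x ≤ 1 := by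
    rw [← hx, parity]
    omega
  rw [hF, fermForm, ← finsum_fullTerm hp hap L hx01.1 hx01.2,
    ← finsum_mem_eq_of_bijOn (f := fullTerm p (bigUnit a) L x (aSeq x b))
      (toPair p (bigUnit a) L x (aSeq x b))
      (bijOn_toPair hp hap L hx) fun y hy => (summand_toPair hp L hx hy).symm]
  refine finsum_congr fun y => ?_
  by_cases hy : Admissible p (bigUnit a) (aSeq x b) y.1
  · simp [hy]
  · simp [hy, fullTerm]

/-! ### Translation of the recurrences -/

theorem F_one_eq_red {p a : ℕ} (hp : 4 ≤ p) (hap : a ≤ p - 2) {x : ℤ}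
    (hx : parity p 0 a 1 = x) (L : ℤ) :
    F p 0 a 1 L = red p (bigUnit a) L (fun i => x * kron 1 i) := by
  rw [F_eq_red hp hap (by omega) hx]
  congr 1
  funext i
  simp [aSeq, bigUnit]

theorem F_eq_red_dirVec {p a b : ℕ} (hp : 4 ≤ p) (hap : a ≤ p - 2) (hb1 : 1 < b) (hb : b ≤ p - 1)
    {x : ℤ} (hx : parity p 0 a b = x) (L : ℤ) :
    F p 0 a b L = red p (bigUnit a) L (dirVec x b) := by
  rw [F_eq_red hp hap hb hx]
  congr 1
  funext i
  simp [aSeq, bigUnit, dirVec, hb1]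

theorem F_succ_eq_ite {p a b : ℕ} (hp : 4 ≤ p) (hap : a ≤ p - 2) (hb1 : 0 < b) (hb : b ≤ p - 1)
    {x : ℤ} (hx : parity p 0 a (b + 1) = x) (L : ℤ) :
    F p 0 a (b + 1) L = if b + 1 = p then 0 else red p (bigUnit a) L (dirVec x (b + 1)) := by
  split_ifs with h
  · exact if_pos h
  · exact F_eq_red_dirVec hp hap (by omega) (by omega) hx L

theorem parity_eq {p a b : ℕ} (hb : b ≠ 1) {x : ℕ}
    (h : (a + (if a = 1 then 1 else 0) + b) % 2 = x) : parity p 0 a b = x := by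
  rw [parity, if_neg hb, if_neg zero_ne_one]
  simpa using congrArg (Nat.cast : ℕ → ℤ) h

theorem parity_one {p a : ℕ} {x : ℕ}
    (h : (a + (if a = 1 then 1 else 0)) % 2 = x) : parity p 0 a 1 = x := by
  have : (a + (if a = 1 then 1 else 0) + 1 + 1) % 2 = x := by omega
  rw [parity, if_pos rfl, if_neg zero_ne_one]
  simpa using congrArg (Nat.cast : ℕ → ℤ) this

end FermionicForm

open FermionicForm in
theorem mainTheorem7 (p a : ℕ) (hp : 4 ≤ p) (ha : 1 ≤ a) (hap : a ≤ p - 2) (L : ℤ) (hL : 1 ≤ L) :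
    ((a + (if a = 1 then 1 else 0)) % 2 = 0 →
      F p 0 a 1 L = F p 0 a 1 (L - 1) + q ^ L / sqrtq * F p 0 a 2 (L - 1)) ∧
    ((a + (if a = 1 then 1 else 0)) % 2 = 1 →
      F p 0 a 1 L = F p 0 a 1 (L - 1) + q ^ (L - 1) * F p 0 a 2 (L - 1)) ∧
    ((a + (if a = 1 then 1 else 0)) % 2 = 0 →
      F p 0 a 2 L = q ^ (L - 1) * F p 0 a 3 (L - 1) + q ^ L / sqrtq * F p 0 a 1 (L - 1)
        + F p 0 a 2 (L - 1)) ∧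
    ((a + (if a = 1 then 1 else 0)) % 2 = 1 →
      F p 0 a 2 L = 1 / sqrtq * F p 0 a 3 (L - 1) + F p 0 a 1 (L - 1)
        + q ^ (L - 1) * F p 0 a 2 (L - 1)) ∧
    (∀ b : ℕ, 2 < b → b ≤ p - 1 → (b + a + (if a = 1 then 1 else 0)) % 2 = 0 →
      F p 0 a b L = q ^ (L - 1) * F p 0 a (b + 1) (L - 1)
        + q ^ L / sqrtq * F p 0 a (b - 1) (L - 1) + F p 0 a b (L - 1)
        + q ^ (L - 1) * (q ^ (L - 1) - 1) * F p 0 a b (L - 2)) ∧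
    (∀ b : ℕ, 2 < b → b ≤ p - 1 → (b + a + (if a = 1 then 1 else 0)) % 2 = 1 →
      F p 0 a b L =
        1 / sqrtq * (F p 0 a (b + 1) (L - 1) + (q ^ (L - 1) - 1) * F p 0 a (b + 1) (L - 2))
        + (F p 0 a (b - 1) (L - 1) + (q ^ (L - 1) - 1) * F p 0 a (b - 1) (L - 2))
        + (F p 0 a b (L - 1) + q ^ (L - 2) * (q ^ (L - 1) - 1) * F p 0 a b (L - 2))) := by
  have hL0 : L ≠ 0 := by omega
  have hw := bigUnit_nonneg a
  refine ⟨fun h => ?_, fun h => ?_, fun h => ?_, fun h => ?_, fun b hb hbp h => ?_,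
    fun b hb hbp h => ?_⟩
  · have h1 := F_one_eq_red hp hap (parity_one h)
    have h2 := F_eq_red_dirVec hp hap (b := 2) (by omega) (by omega)
      (parity_eq (x := 0) (by omega) (by omega))
    rw [h1, h1, h2, Nat.cast_zero, red_rel_one hp 0 hL0, q_zpow_div_sqrtq, mul_zero, sub_zero]
  · have h1 := F_one_eq_red hp hap (parity_one h)
    have h2 := F_eq_red_dirVec hp hap (b := 2) (by omega) (by omega)
      (parity_eq (x := 1) (by omega) (by omega))
    rw [h1, h1, h2, Nat.cast_one, red_rel_one hp 1 hL0, q_zpow]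
    ring_nf
  · have h1 := F_one_eq_red hp hap (parity_one h)
    have h2 := F_eq_red_dirVec hp hap (b := 2) (by omega) (by omega)
      (parity_eq (x := 0) (by omega) (by omega))
    have h3 := F_eq_red_dirVec hp hap (b := 3) (by omega) (by omega)
      (parity_eq (x := 1) (by omega) (by omega))
    rw [h1, h2, h2, h3]
    exact red_rel_two_even hp hw hL0
  · have h1 := F_one_eq_red hp hap (parity_one h)
    have h2 := F_eq_red_dirVec hp hap (b := 2) (by omega) (by omega)
      (parity_eq (x := 1) (by omega) (by omega))
    have h3 := F_eq_red_dirVec hp hap (b := 3) (by omega) (by omega)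
      (parity_eq (x := 0) (by omega) (by omega))
    rw [h1, h2, h2, h3]
    exact red_rel_two_odd hp hw hL0
  · have h1 := F_eq_red_dirVec hp hap (b := b - 1) (by omega) (by omega)
      (parity_eq (x := 1) (by omega) (by omega))
    have h2 := F_eq_red_dirVec hp hap (b := b) (by omega) hbp
      (parity_eq (x := 0) (by omega) (by omega))
    have h3 := F_succ_eq_ite hp hap (b := b) (by omega) hbp
      (parity_eq (x := 1) (by omega) (by omega))
    rw [h1, h2, h2, h2, h3]
    exact red_rel_even hp hw hL0 hb hbp
  · have h1 := F_eq_red_dirVec hp hap (b := b - 1) (by omega) (by omega)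
      (parity_eq (x := 0) (by omega) (by omega))
    have h2 := F_eq_red_dirVec hp hap (b := b) (by omega) hbp
      (parity_eq (x := 1) (by omega) (by omega))
    have h3 := F_succ_eq_ite hp hap (b := b) (by omega) hbp
      (parity_eq (x := 0) (by omega) (by omega))
    rw [h1, h1, h2, h2, h2, h3, h3]
    exact red_rel_odd hp hw hL0 hb hbp
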